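/- Let $\alpha\in(0,1)$ and $\theta>0$. Let $\mu_\alpha(dx)=\frac{\alpha}{\Gamma(1-\alpha)}x^{-\alpha-1}dx$ on $(0,\infty)$. For a counting measure $\sum_i\delta_{x_i}$ on $(0,\infty)$ with $0<\sum_i x_i<\infty$ put $\mathcal V(\sum_i\delta_{x_i})=\sum_i\delta_{x_i/\sum_j x_j}$. The distribution $\mathrm{PD}(\alpha,\theta)$ is defined as follows. Let $\sum_i\delta_{(T_i,P_i,E_i)}$ be a Poisson process on $(0,\infty)^3$ with intensity $\mathrm{Leb}\times\mu_\alpha\times\mathrm{Exp}(1)$ under a probability $\mathbb P$, and let $Z_1=\min\{E_i/P_i: T_i\le 1\}$. Then $\mathrm{PD}(\alpha,\theta)$ is the law of $\mathcal V\bigl(\sum_{T_i\le 1}\delta_{P_i}\bigr)$ under the probability $d\mathbb P^*=\frac{Z_1^\theta}{\Gamma(\theta/\alpha+1)}\,d\mathbb P$. Let $\tilde D\sim\mathrm{gamma}(\theta/\alpha,1)$. (1) Let $N^\vee=\sum_i\delta_{(T^\vee_i,P^\vee_i)}$ be a Poisson process on $(0,\infty)^2$ with intensity $\mathrm{Leb}\times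 e^{-x}\mu_\alpha(dx)$ (for instance the thinning $\sum_i\delta_{(T_i,P_i)}\mathbf 1\{P_i\le E_i\}$ of the process above), independent of $\tilde D$, and let $N^\vee_{\tilde D}=\sum_{T^\vee_i\le\tilde D}\delta_{P^\vee_i}$. Then almost surely the sum of the points of $N^\vee_{\tilde D}$ is positive and finite, and $\mathcal V(N^\vee_{\tilde D})$ has the $\mathrm{PD}(\alpha,\theta)$ distribution. (2) Let $(G_i)_{i\ge1}$ be i.i.d. $\mathrm{gamma}(1-\alpha,1)$ and $(D_i)_{i\ge1}$ i.i.d. $\mathrm{Exp}(1)$ variables, with $\tilde D$, all $G_i$ and all $D_i$ independent; put $\Gamma_i=D_1+\dots+D_i$ and $M^\vee_{\tilde D}=\sum_{i\ge1}\delta_{G_i(\tilde D/(\tilde D+\Gamma_i))^{1/\alpha}}$. Then almost surely the sum of the points of $M^\vee_{\tilde D}$ is positive and finite, and $\mathcal V(M^\vee_{\tilde D})$ has the $\mathrm{PD}(\alpha,\theta)$ distribution. -/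

import Mathlib

open MeasureTheory ProbabilityTheory Set
open scoped ENNReal

noncomputable section

namespace PoissonDirichlet

/-! Point processes are random measures `Ω → Measure X`, where `Measure X` carries the σ-algebra
generated by the evaluations `m ↦ m B`. The counting measure with points `x i` (with
multiplicities) is `Measure.sum fun i => Measure.dirac (x i)`. -/

/-- `m` is a counting measure: a countable sum of unit point masses. -/
def IsCounting {X : Type*} [MeasurableSpace X] (m : Measure X) : Prop :=
  ∃ (ι : Type) (_ : Countable ι) (x : ι → X), m = Measure.sum fun i => Measure.dirac (x i)

/-- `N` is a Poisson point process with intensity measure `ν` under the probability `P`. -/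
structure IsPoissonProcess {Ω X : Type*} [MeasurableSpace Ω] [MeasurableSpace X]
    (P : Measure Ω) (N : Ω → Measure X) (ν : Measure X) : Prop where
  measurable : Measurable N
  counting : ∀ᵐ ω ∂P, IsCounting (N ω)
  /-- The number of points in a set of finite intensity is Poisson distributed. -/
  poisson : ∀ B, MeasurableSet B → ν B ≠ ∞ →
    HasLaw (fun ω => N ω B) ((poissonMeasure (ν B).toNNReal).map fun n : ℕ => (n : ℝ≥0∞)) P
  /-- A set of infinite intensity contains infinitely many points. -/
  infinite : ∀ B, MeasurableSet B → ν B = ∞ → ∀ᵐ ω ∂P, N ω B = ∞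
  /-- The numbers of points in disjoint sets are independent. -/
  indep : ∀ (n : ℕ) (B : Fin n → Set X), (∀ i, MeasurableSet (B i)) →
    Pairwise (fun i j => Disjoint (B i) (B j)) → iIndepFun (fun i ω => N ω (B i)) P

/-- The sum `∑ xᵢ` of the (positive) points of the counting measure `∑ δ_{xᵢ}`. -/
def pointSum (m : Measure ℝ) : ℝ≥0∞ := ∫⁻ x, ENNReal.ofReal x ∂m

/-- Self-normalization `∑ δ_{xᵢ} ↦ ∑ δ_{xᵢ / ∑ⱼ xⱼ}`. -/
def selfNormalize (m : Measure ℝ) : Measure ℝ :=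
  m.map fun x => x / (pointSum m).toReal

/-- Lebesgue measure on the time axis `(0,∞)`. -/
def timeMeasure : Measure ℝ := volume.restrict (Ioi 0)

/-- The Lévy measure `α / Γ(1-α) x^{-(α+1)} dx` on `(0,∞)` of the `α`-stable subordinator. -/
def stableMeasure (α : ℝ) : Measure ℝ :=
  (volume.restrict (Ioi 0)).withDensity fun x =>
    ENNReal.ofReal (α / Real.Gamma (1 - α) * x ^ (-(α + 1)))

/-- The measure `e^{-x} μ_α(dx)` on `(0,∞)`, where `μ_α = stableMeasure α`. -/
def thinnedMeasure (α : ℝ) : Measure ℝ :=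
  (stableMeasure α).withDensity fun x => ENNReal.ofReal (Real.exp (-x))

/-- Intensity of `∑ δ_{(Tᵢ,Pᵢ,Eᵢ)}`: the points `(Tᵢ,Pᵢ)` of a Poisson process with intensity
`Leb × μ_α`, independently marked by standard exponential variables `Eᵢ`. -/
def markedIntensity (α : ℝ) : Measure (ℝ × ℝ × ℝ) :=
  timeMeasure.prod ((stableMeasure α).prod (expMeasure 1))

/-- The thinning `∑ δ_{(Tᵢ,Pᵢ)} 1{Pᵢ ≤ Eᵢ}` of the marked point measure `∑ δ_{(Tᵢ,Pᵢ,Eᵢ)}`. -/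
def thinning (m : Measure (ℝ × ℝ × ℝ)) : Measure (ℝ × ℝ) :=
  (m.restrict {x | x.2.1 ≤ x.2.2}).map fun x => (x.1, x.2.1)

/-- The spatial component `∑_{Tᵢ ≤ s} δ_{Pᵢ}` of `∑ δ_{(Tᵢ,Pᵢ)}` up to time `s`. -/
def upToTime (s : ℝ) (m : Measure (ℝ × ℝ)) : Measure ℝ :=
  (m.restrict {x | x.1 ≤ s}).map Prod.snd

/-- `∑_{Tᵢ ≤ 1} δ_{(Eᵢ/Pᵢ, Pᵢ)}`, from `∑ δ_{(Tᵢ,Pᵢ,Eᵢ)}`. -/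
def sizeBiasedProcess (m : Measure (ℝ × ℝ × ℝ)) : Measure (ℝ × ℝ) :=
  (m.restrict {x | x.1 ≤ 1}).map fun x => (x.2.2 / x.2.1, x.2.1)

/-- The smallest first coordinate `Z₁` of the points `(Zᵢ, P̃ᵢ)` of a point measure. -/
def firstPoint (m : Measure (ℝ × ℝ)) : ℝ :=
  sInf {z : ℝ | m {x | x.1 ≤ z} ≠ 0}

/-- For `0 < α < 1` and `θ > -α`: `Q` is the Poisson-Dirichlet distribution PD(α,θ), as a law on
the counting measures on `ℝ`. It is the law of the self-normalized jumps
`{Pᵢ : Tᵢ ≤ 1}` of the `α`-stable subordinator after the change of measure with density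
`Z₁^θ / Γ(θ/α + 1)`, where `Z₁ = min {Eᵢ/Pᵢ : Tᵢ ≤ 1}` for independent standard exponential
marks `Eᵢ`. -/
def IsPoissonDirichlet (α θ : ℝ) (Q : Measure (Measure ℝ)) : Prop :=
  ∃ (Ω : Type) (_ : MeasurableSpace Ω) (P : Measure Ω) (_ : IsProbabilityMeasure P)
    (N : Ω → Measure (ℝ × ℝ × ℝ)),
    IsPoissonProcess P N (markedIntensity α) ∧
    HasLaw (fun ω => selfNormalize ((sizeBiasedProcess (N ω)).map Prod.snd)) Q
      (P.withDensity fun ω => ENNReal.ofReal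
        (firstPoint (sizeBiasedProcess (N ω)) ^ θ / Real.Gamma (θ / α + 1)))

/-- The counting measure `∑_{i ≥ 1} δ_{Gᵢ (s / (s + Γᵢ))^{1/α}}` with `Γᵢ = D₁ + ⋯ + Dᵢ`
(the sequences are indexed from `0` here). -/
def mixedGammaProcess (α s : ℝ) (G D : ℕ → ℝ) : Measure ℝ :=
  Measure.sum fun i : ℕ => Measure.dirac
    (G i * (s / (s + ∑ j ∈ Finset.range (i + 1), D j)) ^ (1 / α))

theorem measurable_thinning_map :
    Measurable (fun x : ℝ × ℝ × ℝ => ((x.1, x.2.1) : ℝ × ℝ)) := by fun_prop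

theorem measurableSet_thinning : MeasurableSet {x : ℝ × ℝ × ℝ | x.2.1 ≤ x.2.2} :=
  measurableSet_le (by fun_prop) (by fun_prop)

theorem thinning_apply (m : Measure (ℝ × ℝ × ℝ)) {B : Set (ℝ × ℝ)} (hB : MeasurableSet B) :
    thinning m B = m ((fun x => ((x.1, x.2.1) : ℝ × ℝ)) ⁻¹' B ∩ {x | x.2.1 ≤ x.2.2}) := by
  rw [thinning, Measure.map_apply measurable_thinning_map hB,
    Measure.restrict_apply (measurable_thinning_map hB)]

theorem IsCounting.thinning {m : Measure (ℝ × ℝ × ℝ)} (hm : IsCounting m) :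
    IsCounting (thinning m) := by
  obtain ⟨ι, _, x, rfl⟩ := hm
  refine ⟨{i : ι // (x i).2.1 ≤ (x i).2.2}, inferInstance, fun i => ((x i).1, (x i).2.1), ?_⟩
  ext B hB
  have hS := (measurable_thinning_map hB).inter measurableSet_thinning
  rw [thinning_apply _ hB, Measure.sum_apply _ hS, Measure.sum_apply _ hB,
    ← tsum_subtype_eq_of_support_subset
      (s := {i : ι | (x i).2.1 ≤ (x i).2.2})]
  · refine tsum_congr fun i => ?_
    rw [Measure.dirac_apply' _ hS, Measure.dirac_apply' _ hB]
    have := i.2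
    simp only [mem_ofPred_eq] at this
    by_cases h : ((x i).1, (x i).2.1) ∈ B <;> simp [Set.indicator, this, h]
  · intro i hi
    by_contra h
    simp only [mem_ofPred_eq] at h
    simp [Measure.dirac_apply' _ hS, Set.indicator, h] at hi

theorem expMeasure_Ici {a : ℝ} (ha : 0 ≤ a) :
    expMeasure 1 (Ici a) = ENNReal.ofReal (Real.exp (-a)) := by
  have : IsProbabilityMeasure (expMeasure 1) := isProbabilityMeasure_expMeasure one_pos
  have hac : expMeasure 1 ≪ volume := withDensity_absolutelyContinuous _ _
  have h0 : expMeasure 1 {a} = 0 := hac (by simp)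
  have h1 : (expMeasure 1).real (Iic a) = 1 - Real.exp (-a) := by
    rw [← cdf_eq_real, cdf_expMeasure_eq one_pos, if_pos ha, one_mul]
  have h2 : (expMeasure 1).real (Ioi a) = Real.exp (-a) := by
    rw [← compl_Iic, probReal_compl_eq_one_sub measurableSet_Iic, h1]; ring
  have h3 : expMeasure 1 (Ici a) = expMeasure 1 (Ioi a) := by
    refine le_antisymm ?_ (measure_mono Ioi_subset_Ici_self)
    calc expMeasure 1 (Ici a) = expMeasure 1 ({a} ∪ Ioi a) := by
          congr 1; ext x; simp [le_iff_eq_or_lt]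
      _ ≤ _ := (measure_union_le _ _).trans (by rw [h0, zero_add])
  rw [h3, ← h2, ofReal_measureReal]

/-- Thinning turns the marked intensity into `Leb × thinnedMeasure α`. -/
theorem thinning_markedIntensity (α : ℝ) :
    thinning (markedIntensity α) = timeMeasure.prod (thinnedMeasure α) := by
  have : IsProbabilityMeasure (expMeasure 1) := isProbabilityMeasure_expMeasure one_pos
  have hsf : SFinite (stableMeasure α) := by unfold stableMeasure; infer_instance
  have hst : SFinite timeMeasure := by unfold timeMeasure; infer_instance
  have hpos : ∀ᵐ x ∂(stableMeasure α), 0 < x :=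
    (withDensity_absolutelyContinuous _ _).ae_le (ae_restrict_mem measurableSet_Ioi)
  have hd : Measurable fun x : ℝ => ENNReal.ofReal (Real.exp (-x)) := by fun_prop
  ext B hB
  have hS := (measurable_thinning_map hB).inter measurableSet_thinning
  rw [thinning_apply _ hB, markedIntensity, Measure.prod_apply hS, thinnedMeasure,
    Measure.prod_apply hB]
  refine lintegral_congr fun t => ?_
  rw [Measure.prod_apply (measurable_prodMk_left hS),
    withDensity_apply _ (measurable_prodMk_left hB),
    ← lintegral_indicator (measurable_prodMk_left hB)]
  refine lintegral_congr_ae ?_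
  filter_upwards [hpos] with p hp
  by_cases h : (t, p) ∈ B
  · rw [Set.indicator_of_mem (by exact h), ← expMeasure_Ici hp.le]
    congr 1; ext e; simp [h]
  · rw [Set.indicator_of_notMem (by exact h)]
    convert measure_empty (μ := expMeasure 1)
    ext e; simp [h]

/-- The thinning of the marked Poisson process is a Poisson process
with intensity `Leb × thinnedMeasure α`. -/
theorem IsPoissonProcess.thinning {Ω : Type*} [MeasurableSpace Ω] {P : Measure Ω}
    {N : Ω → Measure (ℝ × ℝ × ℝ)} {α : ℝ} (hN : IsPoissonProcess P N (markedIntensity α)) :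
    IsPoissonProcess P (fun ω => thinning (N ω)) (timeMeasure.prod (thinnedMeasure α)) := by
  have hS : ∀ {B : Set (ℝ × ℝ)}, MeasurableSet B → MeasurableSet
      ((fun x : ℝ × ℝ × ℝ => ((x.1, x.2.1) : ℝ × ℝ)) ⁻¹' B ∩ {x | x.2.1 ≤ x.2.2}) :=
    fun hB => (measurable_thinning_map hB).inter measurableSet_thinning
  rw [← thinning_markedIntensity]
  refine ⟨?_, hN.counting.mono fun ω h => h.thinning, fun B hB h => ?_, fun B hB h => ?_,
    fun n B hB hd => ?_⟩
  · refine Measure.measurable_of_measurable_coe _ fun B hB => ?_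
    simp_rw [thinning_apply _ hB]
    exact (Measure.measurable_coe (hS hB)).comp hN.measurable
  · simp_rw [thinning_apply _ hB] at h ⊢
    exact hN.poisson _ (hS hB) h
  · simp_rw [thinning_apply _ hB] at h ⊢
    exact hN.infinite _ (hS hB) h
  · have := hN.indep n _ (fun i => hS (hB i)) fun i j hij =>
      ((hd hij).preimage _).mono inter_subset_left inter_subset_left
    convert this using 3 with i ω
    exact thinning_apply _ (hB i)

end PoissonDirichlet

end

open PoissonDirichlet

open MeasureTheory ProbabilityTheory Set
open scoped ENNReal

noncomputable section

namespace PoissonDirichlet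

open Filter Topology

/-! ### Poisson processes: restriction, mapping, uniqueness in law -/

/-! The change of measure is a gamma mixture in disguise. Let M be the Poisson process of pairs (p,
e) up to time 1, with intensity μ_α × Exp(1), let Z be its smallest ratio e/p, and let V be the
self-normalized first coordinates. The layer-cake formula gives E[Z^θ; V ∈ A] = ∫ θ t^(θ-1) P(no
ratio ≤ t, V ∈ A) dt (`lintegral_firstRatio_rpow`). The pairs with ratio ≤ t have intensity t^α
(`stable_prod_exp_le`), so there are none with probability exp(-t^α). On that event M equals its
restriction to the pairs with ratio > t, which is independent of the event (`indepFun_restrict`). In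
this restriction p carries the weight exp(-tp), and multiplying all points by t, which
self-normalization does not see, turns its intensity into t^α e^(-x) μ_α(dx)
(`map_restrict_stable_prod_exp`). Under s = t^α the remaining weight θ t^(θ-1) exp(-t^α) dt / Γ(θ/α
+ 1) is exactly the gamma(θ/α, 1) law. Thus PD(α, θ) is the mixture, over s with that law, of the
self-normalized Poisson processes with intensity s e^(-x) μ_α(dx) (`map_withDensity_firstRatio`).

Both constructions are mixtures of the same kind: given that the gamma variable equals s, each is a
Poisson process with this intensity. For the process stopped at time s this is restriction and
projection. For the second one, the points (Γ_i, G_i) form a Poisson process with intensity Leb ×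
gamma(1-α, 1), and the map (t, g) ↦ g (s/(s+t))^(1/α) carries that intensity to s e^(-x) μ_α(dx)
(`map_mixedGamma`).

Three general facts support the argument. The intensity determines the law of a Poisson process
(`map_eq_of_isPoissonProcess`). Self-normalization agrees almost surely with a measurable map on the
Poisson processes in question (`regularize`). A marked renewal process with exponential waiting
times is Poisson (`IsMarkedExpSeq.isPoissonProcess`), proved through its generating functional; this
also supplies the marked process on which PD(α, θ) is realized. -/

/-- The law of the number of points of a Poisson process in a set of intensity `x ∈ [0,∞]`. -/
def countLaw (x : ℝ≥0∞) : Measure ℝ≥0∞ :=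
  if x = ∞ then Measure.dirac ∞ else (poissonMeasure x.toNNReal).map fun n : ℕ => (n : ℝ≥0∞)

theorem IsCounting.restrict_map {X Y : Type*} [MeasurableSpace X] [MeasurableSpace Y]
    {m : Measure X} (hm : IsCounting m) {C : Set X} (hC : MeasurableSet C) {f : X → Y}
    (hf : Measurable f) : IsCounting ((m.restrict C).map f) := by
  obtain ⟨ι, _, x, rfl⟩ := hm
  refine ⟨{i : ι // x i ∈ C}, inferInstance, fun i => f (x i), ?_⟩
  ext B hB
  have hS : MeasurableSet (f ⁻¹' B ∩ C) := (hf hB).inter hC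
  rw [Measure.map_apply hf hB, Measure.restrict_apply (hf hB), Measure.sum_apply _ hS,
    Measure.sum_apply _ hB, ← tsum_subtype_eq_of_support_subset (s := {i : ι | x i ∈ C})]
  · refine tsum_congr fun i => ?_
    rw [Measure.dirac_apply' _ hS, Measure.dirac_apply' _ hB]
    have := i.2
    simp only [mem_ofPred_eq] at this
    by_cases h : f (x i) ∈ B <;> simp [Set.indicator, this, h]
  · intro i hi
    by_contra h
    simp only [mem_ofPred_eq] at h
    simp [Measure.dirac_apply' _ hS, Set.indicator, h] at hi

/-- The atoms of the algebra generated by finitely many sets. -/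
def atom {X ι : Type*} (B : ι → Set X) (σ : ι → Bool) : Set X :=
  {x | ∀ i, x ∈ B i ↔ σ i = true}

theorem pairwise_disjoint_atom {X ι : Type*} (B : ι → Set X) :
    Pairwise fun σ τ => Disjoint (atom B σ) (atom B τ) := by
  intro σ τ h
  refine Set.disjoint_left.2 fun x hx hx' => h ?_
  ext i
  rw [Bool.eq_iff_iff, ← hx i, hx' i]

section Basic

variable {Ω Ω' X Y : Type*} [MeasurableSpace Ω] [MeasurableSpace Ω'] [MeasurableSpace X]
  [MeasurableSpace Y] {P : Measure Ω} {P' : Measure Ω'} {N : Ω → Measure X} {N' : Ω' → Measure X}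
  {ν : Measure X}

theorem IsPoissonProcess.measurable_apply (hN : IsPoissonProcess P N ν) {B : Set X}
    (hB : MeasurableSet B) : Measurable fun ω => N ω B :=
  (Measure.measurable_coe hB).comp hN.measurable

theorem IsPoissonProcess.restrict_map (hN : IsPoissonProcess P N ν) {C : Set X}
    (hC : MeasurableSet C) {f : X → Y} (hf : Measurable f) :
    IsPoissonProcess P (fun ω => ((N ω).restrict C).map f) ((ν.restrict C).map f) := by
  have key : ∀ (m : Measure X) {B : Set Y}, MeasurableSet B →
      ((m.restrict C).map f) B = m (f ⁻¹' B ∩ C) := fun m B hB => by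
    rw [Measure.map_apply hf hB, Measure.restrict_apply (hf hB)]
  have hS : ∀ {B : Set Y}, MeasurableSet B → MeasurableSet (f ⁻¹' B ∩ C) :=
    fun hB => (hf hB).inter hC
  refine ⟨?_, hN.counting.mono fun ω h => h.restrict_map hC hf, fun B hB h => ?_,
    fun B hB h => ?_, fun n B hB hd => ?_⟩
  · refine Measure.measurable_of_measurable_coe _ fun B hB => ?_
    simp_rw [key _ hB]
    exact hN.measurable_apply (hS hB)
  · simp_rw [key _ hB] at h ⊢
    exact hN.poisson _ (hS hB) h
  · simp_rw [key _ hB] at h ⊢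
    exact hN.infinite _ (hS hB) h
  · have := hN.indep n _ (fun i => hS (hB i)) fun i j hij =>
      ((hd hij).preimage _).mono inter_subset_left inter_subset_left
    convert this using 3 with i ω
    exact key _ (hB i)

theorem IsPoissonProcess.map (hN : IsPoissonProcess P N ν) {f : X → Y} (hf : Measurable f) :
    IsPoissonProcess P (fun ω => (N ω).map f) (ν.map f) := by
  simpa using hN.restrict_map MeasurableSet.univ hf

theorem IsPoissonProcess.isProbabilityMeasure (hN : IsPoissonProcess P N ν) :
    IsProbabilityMeasure P :=
  -- Independence of the empty family already says that the whole space has measure one.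
  (hN.indep 0 (fun _ => ∅) (fun _ => .empty) fun i => i.elim0).isProbabilityMeasure

theorem IsPoissonProcess.hasLaw_apply (hN : IsPoissonProcess P N ν) {B : Set X}
    (hB : MeasurableSet B) : HasLaw (fun ω => N ω B) (countLaw (ν B)) P := by
  have := hN.isProbabilityMeasure
  unfold countLaw
  split_ifs with h
  · exact hasLaw_dirac_of_ae_eq (hN.infinite B hB h)
  · exact hN.poisson B hB h

theorem IsPoissonProcess.ae_lt_top (hN : IsPoissonProcess P N ν) {B : Set X}
    (hB : MeasurableSet B) (h : ν B ≠ ∞) : ∀ᵐ ω ∂P, N ω B < ∞ := by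
  have := (hN.poisson B hB h).ae_iff (p := fun x => x < ∞)
    (measurableSet_setOfPred.1 measurableSet_Iio)
  rw [this]
  refine (ae_map_iff (by fun_prop) measurableSet_Iio).2 (ae_of_all _ fun n => ?_)
  exact ENNReal.natCast_lt_top n

theorem IsPoissonProcess.measure_eq_zero (hN : IsPoissonProcess P N ν) {B : Set X}
    (hB : MeasurableSet B) (h : ν B ≠ ∞) :
    P {ω | N ω B = 0} = ENNReal.ofReal (Real.exp (-(ν B).toReal)) := by
  rw [(hN.poisson B hB h).measure_eq (p := fun x => x = 0) (measurableSet_singleton 0)]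
  have : (fun n : ℕ => (n : ℝ≥0∞)) ⁻¹' {x | x = 0} = {0} := by ext; simp
  rw [Measure.map_apply (s := {x : ℝ≥0∞ | x = 0}) (by fun_prop) (measurableSet_singleton 0), this,
    poissonMeasure_singleton]
  simp [ENNReal.toReal]

theorem IsPoissonProcess.ae_eq_zero (hN : IsPoissonProcess P N ν) {B : Set X}
    (hB : MeasurableSet B) (h : ν B = 0) : ∀ᵐ ω ∂P, N ω B = 0 := by
  have := hN.isProbabilityMeasure
  have hm : MeasurableSet {ω | N ω B = 0} := hN.measurable_apply hB (measurableSet_singleton 0)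
  refine (prob_compl_eq_zero_iff hm).2 ?_
  rw [hN.measure_eq_zero hB (by simp [h]), h]
  simp

theorem lintegral_poissonMeasure_natCast (r : NNReal) :
    ∫⁻ n : ℕ, (n : ℝ≥0∞) ∂(poissonMeasure r) = r := by
  rw [lintegral_countable']
  simp_rw [poissonMeasure_singleton]
  rw [tsum_eq_zero_add' ENNReal.summable]
  have h : ∀ n : ℕ, ((n + 1 : ℕ) : ℝ≥0∞) *
      ENNReal.ofReal (Real.exp (-r) * r ^ (n + 1) / (n + 1).factorial) =
      r * ENNReal.ofReal (Real.exp (-r) * r ^ n / n.factorial) := fun n => by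
    rw [← ENNReal.ofReal_natCast, ← ENNReal.ofReal_coe_nnreal, ← ENNReal.ofReal_mul (by positivity),
      ← ENNReal.ofReal_mul (by positivity)]
    congr 1
    rw [Nat.factorial_succ]
    push_cast
    field_simp
    ring
  simp_rw [h]
  rw [ENNReal.tsum_mul_left, ← ENNReal.ofReal_tsum_of_nonneg (fun n => by positivity)
    (hasSum_one_poissonMeasure r).summable, (hasSum_one_poissonMeasure r).tsum_eq]
  simp

theorem IsPoissonProcess.lintegral_apply (hN : IsPoissonProcess P N ν) {B : Set X}
    (hB : MeasurableSet B) : ∫⁻ ω, N ω B ∂P = ν B := by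
  have := hN.isProbabilityMeasure
  by_cases h : ν B = ∞
  · rw [lintegral_congr_ae (hN.infinite B hB h), h]
    simp
  · rw [(hN.poisson B hB h).lintegral_comp (f := fun x => x) aemeasurable_id,
      lintegral_map (by fun_prop) (by fun_prop), lintegral_poissonMeasure_natCast,
      ENNReal.coe_toNNReal h]

/-- Campbell's formula. -/
theorem IsPoissonProcess.lintegral_lintegral (hN : IsPoissonProcess P N ν) {f : X → ℝ≥0∞}
    (hf : Measurable f) : ∫⁻ ω, ∫⁻ x, f x ∂(N ω) ∂P = ∫⁻ x, f x ∂ν := by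
  have : P.bind N = ν := by
    ext B hB
    rw [Measure.bind_apply hB hN.measurable.aemeasurable, hN.lintegral_apply hB]
  rw [← this, Measure.lintegral_bind hN.measurable.aemeasurable hf.aemeasurable]

theorem IsPoissonProcess.iIndepFun_apply (hN : IsPoissonProcess P N ν) {ι : Type*} [Fintype ι]
    {B : ι → Set X} (hB : ∀ i, MeasurableSet (B i)) (hd : Pairwise fun i j => Disjoint (B i) (B j)) :
    iIndepFun (fun i ω => N ω (B i)) P := by
  let e := Fintype.equivFin ι
  have := hN.indep (Fintype.card ι) (fun i => B (e.symm i)) (fun i => hB _)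
    fun i j hij => hd (e.symm.injective.ne hij)
  have h2 := this.precomp (g := e) e.injective
  simpa using h2

theorem map_apply_eq_of_disjoint (hN : IsPoissonProcess P N ν) (hN' : IsPoissonProcess P' N' ν)
    {ι : Type*} [Fintype ι]
    {B : ι → Set X} (hB : ∀ i, MeasurableSet (B i)) (hd : Pairwise fun i j => Disjoint (B i) (B j)) :
    P.map (fun ω i => N ω (B i)) = P'.map (fun ω i => N' ω (B i)) := by
  rw [(iIndepFun.hasLaw_pi (fun i => hN.hasLaw_apply (hB i)) (hN.iIndepFun_apply hB hd)).map_eq,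
    (iIndepFun.hasLaw_pi (fun i => hN'.hasLaw_apply (hB i)) (hN'.iIndepFun_apply hB hd)).map_eq]

theorem measurableSet_atom {ι : Type*} [Finite ι] {B : ι → Set X} (hB : ∀ i, MeasurableSet (B i))
    (σ : ι → Bool) : MeasurableSet (atom B σ) := by
  have : atom B σ = ⋂ i, {x | x ∈ B i ↔ σ i = true} := by ext; simp [atom]
  rw [this]
  refine MeasurableSet.iInter fun i => ?_
  cases σ i
  · convert (hB i).compl using 1
    ext; simp
  · convert hB i using 1
    ext; simp

theorem apply_eq_sum_atom {ι : Type*} [Fintype ι] [DecidableEq ι] {B : ι → Set X}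
    (hB : ∀ i, MeasurableSet (B i)) (m : Measure X) (i : ι) :
    m (B i) = ∑ σ : ι → Bool, if σ i then m (atom B σ) else 0 := by
  rw [← Finset.sum_filter, ← measure_biUnion_finset
    (fun σ _ τ _ h => pairwise_disjoint_atom B h) fun σ _ => measurableSet_atom hB σ]
  congr 1
  ext x
  simp only [Finset.mem_filter, Finset.mem_univ, true_and, mem_iUnion, exists_prop]
  classical
  refine ⟨fun hx => ⟨fun j => decide (x ∈ B j), by simpa using hx, fun j => by simp⟩, ?_⟩
  rintro ⟨σ, hσ, hx⟩
  exact (hx i).2 hσ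

/-- Values on overlapping sets are sums of values on the atoms they generate. The atoms are
disjoint, so independence and the one-dimensional laws settle the joint law. -/
theorem map_apply_eq (hN : IsPoissonProcess P N ν) (hN' : IsPoissonProcess P' N' ν)
    {ι : Type*} [Fintype ι] {B : ι → Set X} (hB : ∀ i, MeasurableSet (B i)) :
    P.map (fun ω i => N ω (B i)) = P'.map (fun ω i => N' ω (B i)) := by
  classical
  let T : ((ι → Bool) → ℝ≥0∞) → ι → ℝ≥0∞ := fun c i => ∑ σ : ι → Bool, if σ i then c σ else 0
  have hT : Measurable T := by
    refine measurable_pi_lambda _ fun i => Finset.measurable_sum _ fun σ _ => ?_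
    split_ifs <;> fun_prop
  have h := map_apply_eq_of_disjoint hN hN' (measurableSet_atom hB) (pairwise_disjoint_atom B)
  have h1 : (fun ω i => N ω (B i)) = T ∘ fun ω σ => N ω (atom B σ) := by
    ext ω i; exact apply_eq_sum_atom hB _ i
  have h2 : (fun ω i => N' ω (B i)) = T ∘ fun ω σ => N' ω (atom B σ) := by
    ext ω i; exact apply_eq_sum_atom hB _ i
  have hm : Measurable fun ω (σ : ι → Bool) => N ω (atom B σ) :=
    measurable_pi_lambda _ fun σ => hN.measurable_apply (measurableSet_atom hB σ)
  have hm' : Measurable fun ω (σ : ι → Bool) => N' ω (atom B σ) :=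
    measurable_pi_lambda _ fun σ => hN'.measurable_apply (measurableSet_atom hB σ)
  rw [h1, h2, ← Measure.map_map hT hm, ← Measure.map_map hT hm', h]

/-- A measure, as the family of its values on measurable sets. -/
def evalFamily (m : Measure X) (B : {B : Set X // MeasurableSet B}) : ℝ≥0∞ := m B

/-- This moves questions about laws of random measures to a product space, where finite-dimensional
marginals determine a law. -/
theorem comap_evalFamily :
    MeasurableSpace.comap (evalFamily (X := X)) MeasurableSpace.pi
      = (inferInstance : MeasurableSpace (Measure X)) := by
  rw [MeasurableSpace.pi, MeasurableSpace.comap_iSup]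
  simp_rw [MeasurableSpace.comap_comp]
  rw [iSup_subtype]
  rfl

theorem measurable_evalFamily : Measurable (evalFamily (X := X)) := by
  rw [measurable_iff_comap_le, comap_evalFamily]

/-- The law of a Poisson process is determined by its intensity. -/
theorem map_eq_of_isPoissonProcess (hN : IsPoissonProcess P N ν)
    (hN' : IsPoissonProcess P' N' ν) : P.map N = P'.map N' := by
  have := hN.isProbabilityMeasure
  have := hN'.isProbabilityMeasure
  have hp := Measure.isProbabilityMeasure_map (μ := P) hN.measurable.aemeasurable
  have hp' := Measure.isProbabilityMeasure_map (μ := P') hN'.measurable.aemeasurable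
  have key : (P.map N).map evalFamily = (P'.map N').map evalFamily := by
    have hq := Measure.isProbabilityMeasure_map (μ := P.map N)
      (measurable_evalFamily (X := X)).aemeasurable
    refine IsProjectiveLimit.unique (P := fun I => ((P.map N).map evalFamily).map I.restrict)
      (fun I => rfl) (fun I => ?_)
    have hr : Measurable (I.restrict : ({B : Set X // MeasurableSet B} → ℝ≥0∞) → _) :=
      Finset.measurable_restrict I
    simp only []
    rw [Measure.map_map measurable_evalFamily hN'.measurable,
      Measure.map_map hr (measurable_evalFamily.comp hN'.measurable),
      Measure.map_map measurable_evalFamily hN.measurable,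
      Measure.map_map hr (measurable_evalFamily.comp hN.measurable)]
    exact (map_apply_eq hN hN' (fun i : I => i.1.2)).symm
  ext A hA
  have hA2 : MeasurableSet[MeasurableSpace.comap evalFamily MeasurableSpace.pi] A := by
    rwa [comap_evalFamily]
  obtain ⟨A', hA', rfl⟩ := hA2
  rw [← Measure.map_apply measurable_evalFamily hA', key,
    Measure.map_apply measurable_evalFamily hA']

/-- Upgrades independence of finitely many counts to independence from the whole restricted
configuration. Finitely many values of the restriction are sums over atoms cut down to `C'`, and
these pieces are disjoint from each other and from `C`. -/
theorem IsPoissonProcess.indepFun_restrict (hN : IsPoissonProcess P N ν) {C C' : Set X}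
    (hC : MeasurableSet C) (hC' : MeasurableSet C') (hd : Disjoint C C') :
    IndepFun (fun ω => (N ω).restrict C') (fun ω => N ω C) P := by
  classical
  have := hN.isProbabilityMeasure
  have key : IndepFun (fun ω (B : {B : Set X // MeasurableSet B}) => N ω (B ∩ C'))
      (fun ω => N ω C) P := by
    refine IndepFun.process_indepFun (fun B => hN.measurable_apply (B.2.inter hC'))
      (hN.measurable_apply hC) fun I => ?_
    -- One disjoint family holds everything: `none` indexes `C`, and `some σ` indexes the atoms
    -- inside `C'`.
    let S : Option (I → Bool) → Set X := fun o =>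
      o.elim C fun σ => atom (fun i : I => (i : Set X)) σ ∩ C'
    have hS : ∀ o, MeasurableSet (S o) := by
      rintro (_ | σ)
      · exact hC
      · exact (measurableSet_atom (fun i : I => i.1.2) σ).inter hC'
    have hSd : Pairwise fun o o' => Disjoint (S o) (S o') := by
      rintro (_ | σ) (_ | τ) h
      · exact absurd rfl h
      · exact hd.mono_right inter_subset_right
      · exact (hd.mono_right inter_subset_right).symm
      · exact (pairwise_disjoint_atom _ (fun h' => h (by rw [h']))).mono
          inter_subset_left inter_subset_left
    let J : Finset (Option (I → Bool)) := Finset.univ.image some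
    let J' : Finset (Option (I → Bool)) := {none}
    have hI := (hN.iIndepFun_apply hS hSd).indepFun_finset J J'
      (by simp [J, J']) fun o => hN.measurable_apply (hS o)
    have hmem : ∀ σ : I → Bool, some σ ∈ J :=
      fun σ => by simp [J]
    let T : (J → ℝ≥0∞) → I → ℝ≥0∞ :=
      fun c i => ∑ σ : I → Bool, if σ i then c ⟨some σ, hmem σ⟩ else 0
    have hT : Measurable T := by
      refine measurable_pi_lambda _ fun i => Finset.measurable_sum _ fun σ _ => ?_
      split_ifs <;> fun_prop
    have hU : Measurable fun c : J' → ℝ≥0∞ =>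
        c ⟨none, by simp [J']⟩ := by fun_prop
    refine (hI.comp hT hU).congr (ae_of_all _ fun ω => ?_) (ae_of_all _ fun ω => rfl)
    ext i
    have := apply_eq_sum_atom (B := fun i : I => (i : Set X)) (fun i => i.1.2)
      ((N ω).restrict C') i
    rw [Measure.restrict_apply i.1.2] at this
    refine Eq.trans ?_ this.symm
    refine Finset.sum_congr rfl fun σ _ => ?_
    rw [Measure.restrict_apply (measurableSet_atom (fun i : I => i.1.2) σ)]
    rfl
  rw [IndepFun_iff_Indep] at key ⊢
  refine indep_of_indep_of_le_left key ?_
  rw [← measurable_iff_comap_le]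
  refine Measure.measurable_of_measurable_coe _ fun B hB => ?_
  simp_rw [Measure.restrict_apply hB]
  rw [measurable_iff_comap_le, show (fun ω => N ω (B ∩ C')) =
    (fun c : {B : Set X // MeasurableSet B} → ℝ≥0∞ => c ⟨B, hB⟩) ∘
      (fun ω (B : {B : Set X // MeasurableSet B}) => N ω (B ∩ C')) from rfl,
    ← MeasurableSpace.comap_comp]
  exact MeasurableSpace.comap_mono (measurable_pi_apply _).comap_le

end Basic

/-! ### Marked renewal processes with exponential waiting times -/

theorem lipschitzWith_intervalIntegral {a : ℝ → ℂ} (ha : Measurable a) {C : NNReal}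
    (hC : ∀ u, ‖a u‖ ≤ C) : LipschitzWith C fun s => ∫ u in (0 : ℝ)..s, a u := by
  have hi : ∀ x y, IntervalIntegrable a volume x y := fun x y =>
    (intervalIntegrable_const (c := (C : ℝ))).mono_fun ha.aestronglyMeasurable
      (ae_of_all _ fun u => by simpa using hC u)
  refine LipschitzWith.of_dist_le_mul fun x y => ?_
  rw [dist_eq_norm, intervalIntegral.integral_interval_sub_left (hi _ _) (hi _ _), Real.dist_eq]
  exact intervalIntegral.norm_integral_le_of_norm_le_const fun u _ => hC u

/-- The fundamental theorem of calculus for the exponential of a Lipschitz primitive. -/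
theorem cexp_intervalIntegral_sub_one {a : ℝ → ℂ} (ha : Measurable a) {C : NNReal}
    (hC : ∀ u, ‖a u‖ ≤ C) {b : ℝ} (hb : 0 ≤ b) :
    Complex.exp (∫ u in (0 : ℝ)..b, a u) - 1 =
      ∫ s in (0 : ℝ)..b, a s * Complex.exp (∫ u in (0 : ℝ)..s, a u) := by
  set G : ℝ → ℂ := fun s => ∫ u in (0 : ℝ)..s, a u with hGdef
  have hG : LipschitzWith C G := lipschitzWith_intervalIntegral ha hC
  have hGb : ∀ s ∈ uIcc 0 b, G s ∈ Metric.closedBall (0 : ℂ) (C * b) := by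
    intro s hs
    rw [uIcc_of_le hb] at hs
    have := hG.dist_le_mul s 0
    simp only [hGdef, intervalIntegral.integral_same] at this
    refine Metric.mem_closedBall.2 (this.trans ?_)
    rw [Real.dist_eq, sub_zero, abs_of_nonneg hs.1]
    gcongr
    exact hs.2
  -- The exponential is only locally Lipschitz, hence the ball containing all values of the
  -- primitive on the interval.
  obtain ⟨K, hK⟩ := (Complex.contDiff_exp (𝕜 := ℝ) (n := 1)).contDiffOn.exists_lipschitzOnWith
    (s := Metric.closedBall (0 : ℂ) (C * b)) (by decide) (convex_closedBall _ _)
    (isCompact_closedBall _ _)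
  have hE : LipschitzOnWith (K * C) (fun s => Complex.exp (G s)) (uIcc 0 b) :=
    hK.comp (hG.lipschitzOnWith) hGb
  have hbound : ∀ s ∈ uIcc 0 b, ‖a s * Complex.exp (G s)‖ ≤ C * Real.exp (C * b) := by
    intro s hs
    rw [norm_mul]
    gcongr
    · exact hC s
    · rw [Complex.norm_exp]
      gcongr
      exact (Complex.re_le_norm _).trans (by simpa using hGb s hs)
  let f : ℝ → ℂ := (uIcc 0 b).indicator fun s => a s * Complex.exp (G s)
  have hfm : Measurable f :=
    (ha.mul (Complex.measurable_exp.comp hG.continuous.measurable)).indicator measurableSet_uIcc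
  have hfC : ∀ u, ‖f u‖ ≤ (⟨C * Real.exp (C * b), by positivity⟩ : NNReal) := by
    intro u
    by_cases hu : u ∈ uIcc 0 b
    · simpa only [f, indicator_of_mem hu] using hbound u hu
    · simp only [f, indicator_of_notMem hu, norm_zero]
      positivity
  have hI : LipschitzWith _ fun s => ∫ u in (0 : ℝ)..s, f u := lipschitzWith_intervalIntegral hfm hfC
  have hac := hE.absolutelyContinuousOnInterval.sub
    (hI.lipschitzOnWith (s := uIcc 0 b)).absolutelyContinuousOnInterval
  have hli : ∀ (k : ℝ → ℂ), Measurable k → ∀ (c : ℝ), (∀ u, ‖k u‖ ≤ c) →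
      LocallyIntegrable k volume := fun k hk c hc =>
    (locallyIntegrable_const c).mono hk.aestronglyMeasurable
      (ae_of_all _ fun u => (hc u).trans (le_abs_self c))
  -- As `a` is merely measurable, the primitives are differentiable only almost everywhere. Absolute
  -- continuity is what makes an a.e. zero derivative force a constant.
  have hder := hac.const_of_ae_hasDerivAt_zero (by
    filter_upwards [LocallyIntegrable.ae_hasDerivAt_integral (hli a ha _ hC),
      LocallyIntegrable.ae_hasDerivAt_integral (hli f hfm _ hfC)] with x h1 h2 hx
    have h3 := ((h1 0).cexp).sub (h2 0)
    have : Complex.exp (∫ u in (0 : ℝ)..x, a u) * a x - f x = 0 := by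
      simp only [f, indicator_of_mem hx, hGdef]
      ring
    rw [this] at h3
    exact h3)
  obtain ⟨c, hc⟩ := hder
  have h0 := hc 0 left_mem_uIcc
  have h1 := hc b right_mem_uIcc
  have h2 : ∫ u in (0 : ℝ)..b, f u = ∫ u in (0 : ℝ)..b, a u * Complex.exp (G u) :=
    intervalIntegral.integral_congr fun u hu => by simp only [f, indicator_of_mem hu]
  simp only [hGdef, Pi.sub_apply, intervalIntegral.integral_same, Complex.exp_zero, sub_zero] at h0 h1
  rw [h2, ← h0] at h1
  linear_combination h1

/-- For `E s = exp (∫_s^∞ (g - 1))`, the identity `E s = ∫ e^{-t} g (s + t) E (s + t) dt`. -/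
theorem integral_exp_neg_mul_cexp {g : ℝ → ℂ} (hg : Measurable g) (hg1 : ∀ u, ‖g u‖ ≤ 1)
    (hgi : IntegrableOn (fun u => g u - 1) (Ioi 0)) {s : ℝ} (hs : 0 ≤ s) :
    ∫ t in Ioi (0 : ℝ), (Real.exp (-t) : ℂ) *
      (g (s + t) * Complex.exp (∫ u in Ioi (s + t), (g u - 1))) =
      Complex.exp (∫ u in Ioi s, (g u - 1)) := by
  set A : ℂ := ∫ u in Ioi (0 : ℝ), (g u - 1) with hA
  set E : ℝ → ℂ := fun s => Complex.exp (∫ u in Ioi s, (g u - 1)) with hE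
  -- For s ≥ 0 this is exp(-s) E(s), since the integral of g - 1 over [0, s] is that of g minus s.
  -- In this form the claim is the equation K' = -gK, integrated from s to infinity where K
  -- vanishes.
  set K : ℝ → ℂ := fun s => Complex.exp A * Complex.exp (∫ u in (0 : ℝ)..s, -g u) with hK
  have hgint : ∀ x y, IntervalIntegrable g volume x y := fun x y =>
    (intervalIntegrable_const (c := (1 : ℝ))).mono_fun hg.aestronglyMeasurable
      (ae_of_all _ fun u => by simpa using hg1 u)
  have hEK : ∀ s, 0 ≤ s → K s = Real.exp (-s) * E s := by
    intro s hs
    have h1 : ∫ u in Ioi s, (g u - 1) = A - ∫ u in (0 : ℝ)..s, (g u - 1) := by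
      rw [hA, ← intervalIntegral.integral_interval_add_Ioi (a := 0) (b := s) hgi
        (hgi.mono_set (Ioi_subset_Ioi hs))]
      ring
    rw [intervalIntegral.integral_sub (hgint _ _) (by simp)] at h1
    simp only [hK, hE, h1]
    rw [Complex.ofReal_exp, ← Complex.exp_add, ← Complex.exp_add]
    congr 1
    simp
    ring
  set M : ℝ := ∫ u in Ioi (0 : ℝ), ‖g u - 1‖ with hM
  have hEb : ∀ s, 0 ≤ s → ‖E s‖ ≤ Real.exp M := by
    intro s hs
    simp only [hE, Complex.norm_exp]
    gcongr
    refine (Complex.re_le_norm _).trans ((norm_integral_le_integral_norm _).trans ?_)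
    exact setIntegral_mono_set hgi.norm (ae_of_all _ fun _ => norm_nonneg _)
      (Ioi_subset_Ioi hs).eventuallyLE
  have hKm : Measurable K := by
    have : Continuous fun s => ∫ u in (0 : ℝ)..s, -g u :=
      (lipschitzWith_intervalIntegral (C := 1) hg.neg (by simpa using hg1)).continuous
    exact (continuous_const.mul (Complex.continuous_exp.comp this)).measurable
  have hKb : ∀ s, 0 ≤ s → ‖K s‖ ≤ Real.exp M * Real.exp (-s) := by
    intro s hs
    rw [hEK s hs, norm_mul, mul_comm, Complex.norm_real, Real.norm_of_nonneg (Real.exp_pos _).le]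
    gcongr
    exact hEb s hs
  have hgKi : IntegrableOn (fun u => g u * K u) (Ioi s) := by
    have h1 : IntegrableOn (fun u => Real.exp M * Real.exp (-u)) (Ioi s) :=
      (integrableOn_exp_neg_Ioi s).const_mul _
    refine h1.mono' (hg.mul hKm).aestronglyMeasurable ?_
    filter_upwards [ae_restrict_mem measurableSet_Ioi] with u hu
    rw [norm_mul]
    calc _ ≤ 1 * ‖K u‖ := by gcongr; exact hg1 u
      _ ≤ _ := by rw [one_mul]; exact hKb u (hs.trans (le_of_lt hu))
  have hFTC : ∀ b, 0 ≤ b → K b - K 0 = -∫ u in (0 : ℝ)..b, g u * K u := by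
    intro b hb
    have := cexp_intervalIntegral_sub_one (C := 1) hg.neg (by simpa using hg1) hb
    simp only [Pi.neg_apply] at this
    simp only [hK, intervalIntegral.integral_same, Complex.exp_zero]
    rw [← mul_sub, this, ← intervalIntegral.integral_const_mul, ← intervalIntegral.integral_neg]
    refine intervalIntegral.integral_congr fun u _ => ?_
    ring
  have hgKint : ∀ x y, 0 ≤ x → 0 ≤ y → IntervalIntegrable (fun u => g u * K u) volume x y := by
    intro x y hx hy
    refine (intervalIntegrable_const (c := Real.exp M)).mono_fun (hg.mul hKm).aestronglyMeasurable ?_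
    rw [Filter.EventuallyLE]
    filter_upwards [ae_restrict_mem measurableSet_uIoc] with u hu
    have hu0 : 0 ≤ u := by
      rcases le_total x y with h | h
      · rw [uIoc_of_le h] at hu; exact hx.trans hu.1.le
      · rw [uIoc_of_ge h] at hu; exact hy.trans hu.1.le
    rw [norm_mul, Real.norm_of_nonneg (Real.exp_pos _).le]
    calc _ ≤ 1 * ‖K u‖ := by gcongr; exact hg1 u
      _ ≤ Real.exp M * Real.exp (-u) := by rw [one_mul]; exact hKb u hu0
      _ ≤ Real.exp M * 1 := by gcongr; simpa using hu0
      _ = _ := mul_one _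
  have hK0 : Tendsto K atTop (𝓝 0) := by
    refine squeeze_zero_norm' (a := fun s => Real.exp M * Real.exp (-s)) ?_ ?_
    · filter_upwards [eventually_ge_atTop 0] with s hs using hKb s hs
    · simpa using (Real.tendsto_exp_neg_atTop_nhds_zero).const_mul (Real.exp M)
  have hlim := intervalIntegral_tendsto_integral_Ioi s hgKi tendsto_id
  have hKs : K s = ∫ u in Ioi s, g u * K u := by
    have h1 : Tendsto (fun b => K s - K b) atTop (𝓝 (∫ u in Ioi s, g u * K u)) := by
      refine hlim.congr' ?_
      filter_upwards [eventually_ge_atTop 0] with b hb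
      have h2 := hFTC b hb
      have h3 := hFTC s hs
      have h4 := intervalIntegral.integral_add_adjacent_intervals (hgKint 0 s le_rfl hs)
        (hgKint s b hs hb)
      simp only [id]
      linear_combination h4 - h3 + h2
    have h2 : Tendsto (fun b => K s - K b) atTop (𝓝 (K s - 0)) := tendsto_const_nhds.sub hK0
    rw [sub_zero] at h2
    exact tendsto_nhds_unique h2 h1
  have hshift : ∫ u in Ioi s, g u * K u = ∫ t in Ioi (0 : ℝ), g (s + t) * K (s + t) := by
    have hmp : MeasurePreserving (fun t : ℝ => s + t) := measurePreserving_add_left volume s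
    rw [← hmp.setIntegral_preimage_emb (measurableEmbedding_addLeft s) (fun u => g u * K u) (Ioi s)]
    congr 2
    ext t
    simp
  have hfin : (Real.exp s : ℂ) * K s = E s := by
    rw [hEK s hs, ← mul_assoc, ← Complex.ofReal_mul, ← Real.exp_add]
    simp
  change _ = E s
  rw [← hfin, hKs, hshift, ← integral_const_mul]
  refine setIntegral_congr_fun measurableSet_Ioi fun t ht => ?_
  change (Real.exp (-t) : ℂ) * (g (s + t) * E (s + t)) = Real.exp s * (g (s + t) * K (s + t))
  rw [hEK (s + t) (add_nonneg hs (le_of_lt ht)), neg_add, Real.exp_add, Real.exp_neg s]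
  have : (Real.exp s : ℂ) ≠ 0 := by simp
  push_cast
  field_simp

theorem gammaMeasure_eq_withDensity (a : ℝ) :
    gammaMeasure a 1 = (volume.restrict (Ioi 0)).withDensity fun x =>
      ENNReal.ofReal (x ^ (a - 1) * Real.exp (-x) / Real.Gamma a) := by
  rw [gammaMeasure, ← withDensity_indicator measurableSet_Ioi]
  refine withDensity_congr_ae ?_
  have h0 : ∀ᵐ x : ℝ, x ≠ 0 := by simp [ae_iff]
  filter_upwards [h0] with x hx
  rcases lt_or_gt_of_ne hx with h | h
  · rw [gammaPDF_of_neg h, indicator_of_notMem (by simpa using h.le)]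
  · rw [gammaPDF_of_nonneg h.le, indicator_of_mem (show x ∈ Ioi 0 from h)]
    congr 1
    simp
    ring

theorem expMeasure_eq_withDensity :
    expMeasure 1 = (volume.restrict (Ioi 0)).withDensity fun x =>
      ENNReal.ofReal (Real.exp (-x)) := by
  rw [expMeasure, gammaMeasure_eq_withDensity]
  refine withDensity_congr_ae ?_
  filter_upwards with x
  simp

instance : IsProbabilityMeasure (expMeasure 1) := isProbabilityMeasure_expMeasure one_pos

instance : SFinite timeMeasure := by unfold timeMeasure; infer_instance

theorem integral_expMeasure (f : ℝ → ℂ) :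
    ∫ t, f t ∂(expMeasure 1) = ∫ t in Ioi (0 : ℝ), (Real.exp (-t) : ℂ) * f t := by
  rw [expMeasure_eq_withDensity, integral_withDensity_eq_integral_toReal_smul (by fun_prop)
    (ae_of_all _ fun x => ENNReal.ofReal_lt_top)]
  refine integral_congr_ae (ae_of_all _ fun t => ?_)
  simp [ENNReal.toReal_ofReal (Real.exp_pos _).le]

theorem ae_pos_expMeasure : ∀ᵐ t ∂(expMeasure 1), 0 < t := by
  rw [expMeasure_eq_withDensity]
  exact (withDensity_absolutelyContinuous _ _).ae_le (ae_restrict_mem measurableSet_Ioi)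

/-- A harmonic function for the operator `E ↦ ∫ h (· + t, y) E (· + t) (Exp(1) × π)(dt, dy)`. -/
theorem exists_harmonic {Y : Type*} [MeasurableSpace Y] (π : Measure Y) [IsProbabilityMeasure π]
    {h : ℝ × Y → ℂ} (hm : Measurable h) (h1 : ∀ p, ‖h p‖ ≤ 1)
    (hi : Integrable (fun p => h p - 1) (timeMeasure.prod π)) :
    ∃ E : ℝ → ℂ, Measurable E ∧ (∃ C, ∀ s, ‖E s‖ ≤ C) ∧ Tendsto E atTop (𝓝 1) ∧
      E 0 = Complex.exp (∫ p, (h p - 1) ∂(timeMeasure.prod π)) ∧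
      ∀ s, 0 ≤ s →
        ∫ p, h (s + p.1, p.2) * E (s + p.1) ∂((expMeasure 1).prod π) = E s := by
  set g : ℝ → ℂ := fun u => ∫ y, h (u, y) ∂π with hgdef
  have hhi : ∀ u, Integrable (fun y => h (u, y)) π := fun u =>
    (integrable_const (1 : ℝ)).mono' (hm.comp measurable_prodMk_left).aestronglyMeasurable
      (ae_of_all _ fun y => h1 _)
  have hg : Measurable g := (StronglyMeasurable.integral_prod_right' hm.stronglyMeasurable).measurable
  have hg1 : ∀ u, ‖g u‖ ≤ 1 := fun u => by
    refine (norm_integral_le_of_norm_le_const (ae_of_all _ fun y => h1 (u, y))).trans ?_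
    simp
  have hg1' : ∀ u, ∫ y, (h (u, y) - 1) ∂π = g u - 1 := fun u => by
    rw [integral_sub (hhi u) (integrable_const _)]
    simp [hgdef]
  have hgi : IntegrableOn (fun u => g u - 1) (Ioi 0) := by
    have := hi.integral_prod_left
    simp_rw [hg1'] at this
    exact this
  have hA : ∫ p, (h p - 1) ∂(timeMeasure.prod π) = ∫ u in Ioi (0 : ℝ), (g u - 1) := by
    rw [integral_prod _ hi]
    simp_rw [hg1']
    rfl
  have hgint : ∀ x y, IntervalIntegrable (fun u => g u - 1) volume x y := fun x y =>
    ((intervalIntegrable_const (c := (1 : ℝ))).mono_fun hg.aestronglyMeasurable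
      (ae_of_all _ fun u => by simpa using hg1 u)).sub intervalIntegrable_const
  -- Integrability of g - 1 is known only on (0, ∞); the truncation `max s 0` keeps E continuous and
  -- bounded on the whole line.
  set E : ℝ → ℂ := fun s => Complex.exp (∫ u in Ioi (max s 0), (g u - 1)) with hE
  have hE0 : ∀ s, 0 ≤ s → E s = Complex.exp (∫ u in Ioi s, (g u - 1)) := fun s hs => by
    simp only [hE, max_eq_left hs]
  have hEalt : E = fun s => Complex.exp ((∫ u in Ioi (0 : ℝ), (g u - 1)) -
      ∫ u in (0 : ℝ)..(max s 0), (g u - 1)) := by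
    ext s
    simp only [hE]
    rw [← intervalIntegral.integral_interval_add_Ioi (a := 0) (b := max s 0) hgi
        (hgi.mono_set (Ioi_subset_Ioi (le_max_right s 0)))]
    congr 1
    ring
  have hg2 : ∀ u, ‖g u - 1‖ ≤ (2 : NNReal) := fun u =>
    (norm_sub_le _ _).trans (by have := hg1 u; simp; linarith)
  have hcont : Continuous E := by
    rw [hEalt]
    have : Continuous fun s => ∫ u in (0 : ℝ)..s, (g u - 1) :=
      (lipschitzWith_intervalIntegral (hg.sub_const 1) hg2).continuous
    fun_prop
  have hEC : ∀ s, ‖E s‖ ≤ Real.exp (∫ u in Ioi (0 : ℝ), ‖g u - 1‖) := fun s => by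
    simp only [hE, Complex.norm_exp]
    gcongr
    refine (Complex.re_le_norm _).trans ((norm_integral_le_integral_norm _).trans ?_)
    exact setIntegral_mono_set hgi.norm (ae_of_all _ fun _ => norm_nonneg _)
      (Ioi_subset_Ioi (le_max_right s 0)).eventuallyLE
  refine ⟨E, hcont.measurable, ⟨_, hEC⟩, ?_, ?_, fun s hs => ?_⟩
  · rw [hEalt]
    have h2 := intervalIntegral_tendsto_integral_Ioi 0 hgi
      (tendsto_atTop_mono (fun s : ℝ => le_max_left s 0) tendsto_id)
    simpa using (h2.const_sub (∫ u in Ioi (0 : ℝ), (g u - 1))).cexp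
  · rw [hA, hE0 0 le_rfl]
  · have hint : Integrable (fun p : ℝ × Y => h (s + p.1, p.2) * E (s + p.1))
        ((expMeasure 1).prod π) := by
      refine (integrable_const (Real.exp (∫ u in Ioi (0 : ℝ), ‖g u - 1‖))).mono' ?_ ?_
      · have h3 : Measurable fun p : ℝ × Y => h (s + p.1, p.2) := hm.comp (by fun_prop)
        have h4 : Measurable fun p : ℝ × Y => E (s + p.1) := hcont.measurable.comp (by fun_prop)
        exact (h3.mul h4).aestronglyMeasurable
      · refine ae_of_all _ fun p => ?_
        rw [norm_mul]
        calc _ ≤ 1 * ‖E (s + p.1)‖ := by gcongr; exact h1 _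
          _ ≤ _ := by rw [one_mul]; exact hEC _
    rw [integral_prod _ hint]
    simp_rw [integral_mul_const]
    rw [integral_expMeasure, hE0 s hs, ← integral_exp_neg_mul_cexp hg hg1 hgi hs]
    refine setIntegral_congr_fun measurableSet_Ioi fun t ht => ?_
    simp only [hgdef]
    rw [hE0 (s + t) (add_nonneg hs (le_of_lt ht))]

theorem IsMarkedExpSeq.measurable_past {Ω Y : Type*} [MeasurableSpace Y] {D : ℕ → Ω → ℝ} {Z : ℕ → Ω → Y} (i n : ℕ) (hin : i < n) :
    Measurable[⨆ i ∈ Iio n, MeasurableSpace.comap (fun ω => (D i ω, Z i ω)) inferInstance]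
      fun ω => (D i ω, Z i ω) := by
  rw [measurable_iff_comap_le]
  exact le_iSup₂_of_le i hin le_rfl

theorem IsMarkedExpSeq.measurable_past_sum {Ω Y : Type*} [MeasurableSpace Y] {D : ℕ → Ω → ℝ}
    {Z : ℕ → Ω → Y} (n m : ℕ) (hnm : m ≤ n) :
    Measurable[⨆ i ∈ Iio n, MeasurableSpace.comap (fun ω => (D i ω, Z i ω)) inferInstance]
      fun ω => ∑ j ∈ Finset.range m, D j ω := by
  refine @Finset.measurable_sum _ _ _ _ _ _ (_) _ _ fun j hj => ?_
  exact measurable_fst.comp (IsMarkedExpSeq.measurable_past j n (by simp at hj; omega))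

theorem IsMarkedExpSeq.measurable_past_prod {Ω Y : Type*} [MeasurableSpace Y] {D : ℕ → Ω → ℝ}
    {Z : ℕ → Ω → Y} {h : ℝ × Y → ℂ} (hm : Measurable h) (n : ℕ) :
    Measurable[⨆ i ∈ Iio n, MeasurableSpace.comap (fun ω => (D i ω, Z i ω)) inferInstance]
      fun ω => ∏ i ∈ Finset.range n, h (∑ j ∈ Finset.range (i + 1), D j ω, Z i ω) := by
  refine @Finset.measurable_prod _ _ _ _ _ _ (_) _ _ fun i hi => ?_
  have hi' : i < n := by simpa using hi
  refine hm.comp ?_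
  exact @Measurable.prodMk _ _ _ _ _ (_) _ _ (IsMarkedExpSeq.measurable_past_sum n (i + 1) hi')
    (measurable_snd.comp (IsMarkedExpSeq.measurable_past i n hi'))

section Renewal

variable {Ω Y : Type*} [MeasurableSpace Ω] [MeasurableSpace Y] {P : Measure Ω}

/-- `∑ δ_{(d₀ + ⋯ + dᵢ, zᵢ)}`. -/
def renewalProcess (d : ℕ → ℝ) (z : ℕ → Y) : Measure (ℝ × Y) :=
  Measure.sum fun i : ℕ => Measure.dirac (∑ j ∈ Finset.range (i + 1), d j, z i)

/-- The variables `(Dᵢ, Zᵢ)` are i.i.d. with law `Exp(1) × π`. -/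
structure IsMarkedExpSeq (P : Measure Ω) (D : ℕ → Ω → ℝ) (Z : ℕ → Ω → Y) (π : Measure Y) :
    Prop where
  measurable_waiting : ∀ i, Measurable (D i)
  measurable_mark : ∀ i, Measurable (Z i)
  indep : iIndepFun (fun i ω => (D i ω, Z i ω)) P
  hasLaw : ∀ i, HasLaw (fun ω => (D i ω, Z i ω)) ((expMeasure 1).prod π) P

namespace IsMarkedExpSeq

variable {D : ℕ → Ω → ℝ} {Z : ℕ → Ω → Y} {π : Measure Y}

theorem indepFun_past (hD : IsMarkedExpSeq P D Z π) {A : Type*} [MeasurableSpace A]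
    {U : Ω → A} {n : ℕ}
    (hU : Measurable[⨆ i ∈ Iio n, MeasurableSpace.comap (fun ω => (D i ω, Z i ω)) inferInstance] U) :
    IndepFun U (fun ω => (D n ω, Z n ω)) P := by
  rw [IndepFun_iff_Indep]
  have h := indep_iSup_of_disjoint (S := Iio n) (T := {n})
    (fun i => ((hD.measurable_waiting i).prodMk (hD.measurable_mark i)).comap_le) hD.indep.iIndep
    (by simp)
  simp only [mem_singleton_iff, iSup_iSup_eq_left] at h
  exact indep_of_indep_of_le_left h hU.comap_le

theorem measurable_sum (hD : IsMarkedExpSeq P D Z π) (n : ℕ) :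
    Measurable fun ω => ∑ j ∈ Finset.range n, D j ω :=
  Finset.measurable_sum _ fun j _ => hD.measurable_waiting j

theorem ae_pos (hD : IsMarkedExpSeq P D Z π) [IsProbabilityMeasure π] :
    ∀ᵐ ω ∂P, ∀ i, 0 < D i ω := by
  rw [ae_all_iff]
  intro i
  have h1 : ∀ᵐ p ∂((expMeasure 1).prod π), 0 < p.1 :=
    Measure.quasiMeasurePreserving_fst.ae ae_pos_expMeasure
  rw [← (hD.hasLaw i).map_eq] at h1
  exact ae_of_ae_map (hD.hasLaw i).aemeasurable h1

theorem ae_sum_nonneg (hD : IsMarkedExpSeq P D Z π) [IsProbabilityMeasure π] :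
    ∀ᵐ ω ∂P, ∀ n, 0 ≤ ∑ j ∈ Finset.range n, D j ω := by
  filter_upwards [hD.ae_pos] with ω hω n
  exact Finset.sum_nonneg fun j _ => (hω j).le

/-- Conditioning on the past: the expectation of `F (past, (Dₙ, Zₙ))`. -/
theorem integral_past (hD : IsMarkedExpSeq P D Z π) [IsProbabilityMeasure π]
    {A : Type*} [MeasurableSpace A] {U : Ω → A} {n : ℕ} (hUm : Measurable U)
    (hU : Measurable[⨆ i ∈ Iio n, MeasurableSpace.comap (fun ω => (D i ω, Z i ω)) inferInstance] U)
    {F : A × (ℝ × Y) → ℂ} (hF : Measurable F) {C : ℝ}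
    (hC : ∀ᵐ ω ∂P, ∀ p, ‖F (U ω, p)‖ ≤ C) :
    ∫ ω, F (U ω, (D n ω, Z n ω)) ∂P = ∫ ω, ∫ p, F (U ω, p) ∂((expMeasure 1).prod π) ∂P := by
  have := hD.indep.isProbabilityMeasure
  have hind := hD.indepFun_past hU
  have hξ : Measurable fun ω => (D n ω, Z n ω) :=
    (hD.measurable_waiting n).prodMk (hD.measurable_mark n)
  have hlaw := (indepFun_iff_map_prod_eq_prod_map_map hUm.aemeasurable hξ.aemeasurable).1 hind
  rw [(hD.hasLaw n).map_eq] at hlaw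
  have hp := Measure.isProbabilityMeasure_map (μ := P) hUm.aemeasurable
  have hint : Integrable F ((P.map U).prod ((expMeasure 1).prod π)) := by
    rw [← hlaw, integrable_map_measure hF.aestronglyMeasurable (hUm.prodMk hξ).aemeasurable]
    refine (integrable_const C).mono' (hF.comp (hUm.prodMk hξ)).aestronglyMeasurable ?_
    filter_upwards [hC] with ω hω using hω _
  calc _ = ∫ q, F q ∂(P.map fun ω => (U ω, (D n ω, Z n ω))) :=
        (integral_map (hUm.prodMk hξ).aemeasurable hF.aestronglyMeasurable).symm
    _ = ∫ a, ∫ p, F (a, p) ∂((expMeasure 1).prod π) ∂(P.map U) := by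
        rw [hlaw, integral_prod _ hint]
    _ = _ := integral_map hUm.aemeasurable
        (StronglyMeasurable.integral_prod_right' hF.stronglyMeasurable).aestronglyMeasurable

/-- Martingale property: conditioning on the first n pairs and integrating out the next one
reproduces E by harmonicity, so the expectation stays at its value for n = 0. -/
theorem integral_prod_mul_harmonic (hD : IsMarkedExpSeq P D Z π) [IsProbabilityMeasure π]
    {h : ℝ × Y → ℂ} (hm : Measurable h) (h1 : ∀ p, ‖h p‖ ≤ 1) {E : ℝ → ℂ} (hE : Measurable E)
    {C : ℝ} (hC : ∀ s, ‖E s‖ ≤ C)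
    (hEh : ∀ s, 0 ≤ s →
        ∫ p, h (s + p.1, p.2) * E (s + p.1) ∂((expMeasure 1).prod π) = E s) (n : ℕ) :
    ∫ ω, (∏ i ∈ Finset.range n, h (∑ j ∈ Finset.range (i + 1), D j ω, Z i ω)) *
      E (∑ j ∈ Finset.range n, D j ω) ∂P = E 0 := by
  have := hD.indep.isProbabilityMeasure
  induction n with
  | zero => simp
  | succ n ih =>
    rw [← ih]
    let U : Ω → ℂ × ℝ := fun ω =>
      (∏ i ∈ Finset.range n, h (∑ j ∈ Finset.range (i + 1), D j ω, Z i ω),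
        ∑ j ∈ Finset.range n, D j ω)
    let F : (ℂ × ℝ) × (ℝ × Y) → ℂ := fun q =>
      q.1.1 * (h (q.1.2 + q.2.1, q.2.2) * E (q.1.2 + q.2.1))
    have hF : Measurable F := by
      have h3 : Measurable fun q : (ℂ × ℝ) × (ℝ × Y) => h (q.1.2 + q.2.1, q.2.2) :=
        hm.comp (by fun_prop)
      have h4 : Measurable fun q : (ℂ × ℝ) × (ℝ × Y) => E (q.1.2 + q.2.1) :=
        hE.comp (by fun_prop)
      exact (_root_.measurable_fst.fst).mul (h3.mul h4)
    have hUp : Measurable[⨆ i ∈ Iio n, MeasurableSpace.comap (fun ω => (D i ω, Z i ω))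
        inferInstance] U :=
      @Measurable.prodMk _ _ _ _ _ (_) _ _ (measurable_past_prod hm n)
        (measurable_past_sum n n le_rfl)
    have hUm : Measurable U := hUp.mono (iSup₂_le fun i _ =>
      ((hD.measurable_waiting i).prodMk (hD.measurable_mark i)).comap_le) le_rfl
    have hFC : ∀ᵐ ω ∂P, ∀ p, ‖F (U ω, p)‖ ≤ C := by
      refine ae_of_all _ fun ω p => ?_
      simp only [F, U, norm_mul, norm_prod]
      calc _ ≤ 1 * (1 * C) := by
            have := (norm_nonneg _).trans (hC 0)
            gcongr
            · exact Finset.prod_le_one (fun _ _ => norm_nonneg _) fun _ _ => h1 _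
            · exact h1 _
            · exact hC _
        _ = C := by ring
    have key := hD.integral_past hUm hUp hF hFC
    calc _ = ∫ ω, F (U ω, (D n ω, Z n ω)) ∂P := by
          refine integral_congr_ae (ae_of_all _ fun ω => ?_)
          simp only [F, U, Finset.prod_range_succ, Finset.sum_range_succ]
          ring
      _ = _ := by
          rw [key]
          refine integral_congr_ae ?_
          filter_upwards [hD.ae_sum_nonneg] with ω hω
          simp only [F, U]
          rw [integral_const_mul, hEh _ (hω n)]

theorem lintegral_exp_neg (hD : IsMarkedExpSeq P D Z π) [IsProbabilityMeasure π] (i : ℕ) :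
    ∫⁻ ω, ENNReal.ofReal (Real.exp (-D i ω)) ∂P = 2⁻¹ := by
  have h1 := (hD.hasLaw i).lintegral_comp (f := fun p => ENNReal.ofReal (Real.exp (-p.1)))
    (by fun_prop)
  simp only at h1
  rw [h1, lintegral_prod _ (by fun_prop)]
  simp only [lintegral_const, measure_univ, mul_one]
  rw [expMeasure_eq_withDensity, lintegral_withDensity_eq_lintegral_mul _ (by fun_prop)
    (by fun_prop)]
  simp only [Pi.mul_apply, ← ENNReal.ofReal_mul (Real.exp_pos _).le, ← Real.exp_add]
  have h2 : ∀ x : ℝ, -x + -x = -2 * x := fun x => by ring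
  simp_rw [h2]
  rw [← ofReal_integral_eq_lintegral_ofReal (integrableOn_exp_mul_Ioi (by norm_num) 0)
    (ae_of_all _ fun x => (Real.exp_pos _).le), integral_exp_mul_Ioi (by norm_num)]
  simp [ENNReal.ofReal_inv_of_pos]

theorem lintegral_exp_neg_sum (hD : IsMarkedExpSeq P D Z π) [IsProbabilityMeasure π] (n : ℕ) :
    ∫⁻ ω, ENNReal.ofReal (Real.exp (-∑ j ∈ Finset.range n, D j ω)) ∂P = 2⁻¹ ^ n := by
  have h1 : iIndepFun (fun j ω => ENNReal.ofReal (Real.exp (-D j ω))) P :=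
    hD.indep.comp (fun _ p => ENNReal.ofReal (Real.exp (-p.1)))
      fun _ => by fun_prop
  have h2 := lintegral_prod_eq_prod_lintegral_of_indepFun (Finset.range n) _ h1
    fun j => by have := hD.measurable_waiting j; fun_prop
  simp_rw [hD.lintegral_exp_neg, Finset.prod_const, Finset.card_range] at h2
  rw [← h2]
  refine lintegral_congr fun ω => ?_
  rw [← Finset.sum_neg_distrib, Real.exp_sum,
    ENNReal.ofReal_prod_of_nonneg fun _ _ => (Real.exp_pos _).le]

/-- The expectations of exp(-Γ_n) are 2^(-n), hence summable. Almost surely the series of exp(-Γ_n)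
then converges and its terms tend to zero. -/
theorem ae_tendsto_sum (hD : IsMarkedExpSeq P D Z π) [IsProbabilityMeasure π] :
    ∀ᵐ ω ∂P, Tendsto (fun n => ∑ j ∈ Finset.range n, D j ω) atTop atTop := by
  have hm : ∀ n, Measurable fun ω =>
      ENNReal.ofReal (Real.exp (-∑ j ∈ Finset.range n, D j ω)) := fun n => by
    have := hD.measurable_sum n
    fun_prop
  have h1 : ∫⁻ ω, ∑' n, ENNReal.ofReal (Real.exp (-∑ j ∈ Finset.range n, D j ω)) ∂P ≠ ∞ := by
    rw [lintegral_tsum fun n => (hm n).aemeasurable]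
    simp_rw [hD.lintegral_exp_neg_sum]
    rw [ENNReal.tsum_geometric]
    simp
  filter_upwards [ae_lt_top (Measurable.tsum hm) h1] with ω hω
  have h2 := ENNReal.tendsto_atTop_zero_of_tsum_ne_top hω.ne
  have h3 := (ENNReal.tendsto_toReal ENNReal.zero_ne_top).comp h2
  have h4 : Tendsto (fun n => Real.exp (-∑ j ∈ Finset.range n, D j ω)) atTop (𝓝 0) := by
    refine h3.congr fun n => ?_
    simp [ENNReal.toReal_ofReal (Real.exp_pos _).le]
  rw [Real.tendsto_exp_comp_nhds_zero] at h4
  simpa [Function.comp_def] using tendsto_neg_atBot_atTop.comp h4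

/-- The generating functional of a marked renewal process. -/
theorem tendsto_integral_prod (hD : IsMarkedExpSeq P D Z π) [IsProbabilityMeasure π]
    {h : ℝ × Y → ℂ} (hm : Measurable h) (h1 : ∀ p, ‖h p‖ ≤ 1)
    (hi : Integrable (fun p => h p - 1) (timeMeasure.prod π)) :
    Tendsto (fun n => ∫ ω, ∏ i ∈ Finset.range n,
        h (∑ j ∈ Finset.range (i + 1), D j ω, Z i ω) ∂P) atTop
      (𝓝 (Complex.exp (∫ p, (h p - 1) ∂(timeMeasure.prod π)))) := by
  have := hD.indep.isProbabilityMeasure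
  obtain ⟨E, hE, ⟨C, hC⟩, hE1, hE0, hEh⟩ := exists_harmonic π hm h1 hi
  rw [← hE0]
  set Q : ℕ → Ω → ℂ := fun n ω => ∏ i ∈ Finset.range n,
    h (∑ j ∈ Finset.range (i + 1), D j ω, Z i ω) with hQ
  have hQm : ∀ n, Measurable (Q n) := fun n => Finset.measurable_prod _ fun i _ =>
    hm.comp ((hD.measurable_sum _).prodMk (hD.measurable_mark i))
  have hQ1 : ∀ n ω, ‖Q n ω‖ ≤ 1 := fun n ω => by
    simp only [hQ, norm_prod]
    exact Finset.prod_le_one (fun _ _ => norm_nonneg _) fun _ _ => h1 _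
  have hEm : ∀ n, Measurable fun ω => E (∑ j ∈ Finset.range n, D j ω) := fun n =>
    hE.comp (hD.measurable_sum n)
  -- The products are bounded by one and E tends to 1 along the diverging partial sums, so the
  -- factor E may be dropped in the limit; with it the expectation is exactly `E 0` for every n.
  have hlim : Tendsto (fun n => ∫ ω, Q n ω * (E (∑ j ∈ Finset.range n, D j ω) - 1) ∂P) atTop
      (𝓝 (∫ _, (0 : ℂ) ∂P)) := by
    refine tendsto_integral_of_dominated_convergence (fun _ => C + 1)
      (fun n => ((hQm n).mul ((hEm n).sub_const 1)).aestronglyMeasurable) (integrable_const _)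
      (fun n => ae_of_all _ fun ω => ?_) ?_
    · rw [norm_mul]
      calc _ ≤ 1 * (C + 1) := by
            gcongr
            · exact hQ1 n ω
            · exact (norm_sub_le _ _).trans (by simpa using hC _)
        _ = _ := one_mul _
    · filter_upwards [hD.ae_tendsto_sum] with ω hω
      refine squeeze_zero_norm (a := fun n => ‖E (∑ j ∈ Finset.range n, D j ω) - 1‖)
        (fun n => ?_) ?_
      · rw [norm_mul]
        exact mul_le_of_le_one_left (norm_nonneg _) (hQ1 n ω)
      · simpa using ((hE1.comp hω).sub_const 1).norm
  rw [integral_zero] at hlim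
  have h2 := hlim.const_sub (E 0)
  rw [sub_zero] at h2
  refine h2.congr fun n => ?_
  have hbd : ∀ {f : Ω → ℂ}, Measurable f → ∀ c : ℝ, (∀ ω, ‖f ω‖ ≤ c) → Integrable f P :=
    fun hf c hc => (integrable_const c).mono' hf.aestronglyMeasurable (ae_of_all _ hc)
  have hi1 : Integrable (fun ω => Q n ω * E (∑ j ∈ Finset.range n, D j ω)) P := by
    refine hbd ((hQm n).mul (hEm n)) (1 * C) fun ω => ?_
    rw [norm_mul]
    gcongr
    · exact hQ1 n ω
    · exact hC _
  rw [← hD.integral_prod_mul_harmonic hm h1 hE hC hEh n]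
  change ∫ ω, Q n ω * E (∑ j ∈ Finset.range n, D j ω) ∂P - _ = _
  rw [← integral_sub hi1]
  · refine integral_congr_ae (ae_of_all _ fun ω => ?_)
    simp only [hQ]
    ring
  · simp_rw [mul_sub, mul_one]
    exact hi1.sub (hbd (hQm n) 1 (hQ1 n))

end IsMarkedExpSeq

end Renewal

/-! ### The marked renewal process is a Poisson process -/

/-- The number of `i < n` with `x i ∈ B`. -/
def hitCount {X : Type*} (x : ℕ → X) (B : Set X) (n : ℕ) : ℕ :=
  ∑ i ∈ Finset.range n, B.indicator (fun _ => 1) (x i)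

theorem tendsto_hitCount {X : Type*} [MeasurableSpace X] (x : ℕ → X) {B : Set X}
    (hB : MeasurableSet B) : Tendsto (fun n => (hitCount x B n : ℝ≥0∞)) atTop
      (𝓝 ((Measure.sum fun i => Measure.dirac (x i)) B)) := by
  rw [Measure.sum_apply _ hB]
  convert (ENNReal.tendsto_nat_tsum fun i => Measure.dirac (x i) B) using 2 with n
  simp only [hitCount, Nat.cast_sum]
  refine Finset.sum_congr rfl fun i _ => ?_
  rw [Measure.dirac_apply' _ hB]
  by_cases h : x i ∈ B <;> simp [h]

theorem hitCount_le {X : Type*} [MeasurableSpace X] (x : ℕ → X) {B : Set X}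
    (hB : MeasurableSet B) (n : ℕ) :
    (hitCount x B n : ℝ≥0∞) ≤ (Measure.sum fun i => Measure.dirac (x i)) B := by
  refine Monotone.ge_of_tendsto (fun m n hmn => ?_) (tendsto_hitCount x hB) n
  simp only [hitCount]
  gcongr

theorem hitCount_mono {X : Type*} (x : ℕ → X) {B C : Set X} (h : B ⊆ C) (n : ℕ) :
    hitCount x B n ≤ hitCount x C n :=
  Finset.sum_le_sum fun _ _ => indicator_le_indicator_of_subset h (fun _ => Nat.zero_le _) _

theorem tendsto_hitCount_real {X : Type*} [MeasurableSpace X] (x : ℕ → X) {B : Set X}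
    (hB : MeasurableSet B) (h : (Measure.sum fun i => Measure.dirac (x i)) B ≠ ∞) :
    Tendsto (fun n => (hitCount x B n : ℝ)) atTop
      (𝓝 ((Measure.sum fun i => Measure.dirac (x i)) B).toReal) := by
  simpa [Function.comp_def] using (ENNReal.tendsto_toReal h).comp (tendsto_hitCount x hB)

theorem tendsto_hitCount_atTop {X : Type*} [MeasurableSpace X] (x : ℕ → X) {B : Set X}
    (hB : MeasurableSet B) (h : (Measure.sum fun i => Measure.dirac (x i)) B = ∞) :
    Tendsto (hitCount x B) atTop atTop := by
  have := tendsto_hitCount x hB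
  rw [h] at this
  refine tendsto_atTop.2 fun b => ?_
  filter_upwards [this.eventually (lt_mem_nhds (ENNReal.natCast_lt_top b))] with n hn
  exact_mod_cast hn.le

section Renewal

variable {Ω Y : Type*} [MeasurableSpace Ω] [MeasurableSpace Y] {P : Measure Ω}
  {D : ℕ → Ω → ℝ} {Z : ℕ → Ω → Y} {π : Measure Y}

namespace IsMarkedExpSeq

theorem measurable_point (hD : IsMarkedExpSeq P D Z π) (i : ℕ) :
    Measurable fun ω => (∑ j ∈ Finset.range (i + 1), D j ω, Z i ω) :=
  (hD.measurable_sum _).prodMk (hD.measurable_mark i)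

theorem measurable_hitCount (hD : IsMarkedExpSeq P D Z π) {B : Set (ℝ × Y)}
    (hB : MeasurableSet B) (n : ℕ) :
    Measurable fun ω => hitCount (fun i => (∑ j ∈ Finset.range (i + 1), D j ω, Z i ω)) B n :=
  Finset.measurable_sum _ fun i _ => (measurable_const.indicator hB).comp (hD.measurable_point i)

theorem measurable_renewalProcess (hD : IsMarkedExpSeq P D Z π) :
    Measurable fun ω => renewalProcess (D · ω) (Z · ω) := by
  refine Measure.measurable_of_measurable_coe _ fun B hB => ?_
  simp only [renewalProcess, Measure.sum_apply _ hB, Measure.dirac_apply' _ hB]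
  exact Measurable.tsum fun i => (measurable_const.indicator hB).comp (hD.measurable_point i)

/-- The generating functional at h = r^(1_B). The counts are truncated to finitely many points
because it is not yet known that the limiting count is finite. -/
theorem tendsto_integral_pow_hitCount (hD : IsMarkedExpSeq P D Z π) [IsProbabilityMeasure π]
    {B : Set (ℝ × Y)} (hB : MeasurableSet B) (hν : timeMeasure.prod π B ≠ ∞) {r : ℝ}
    (hr0 : 0 ≤ r) (hr1 : r ≤ 1) :
    Tendsto (fun n => ∫ ω, r ^ hitCount (fun i => (∑ j ∈ Finset.range (i + 1), D j ω, Z i ω)) B n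
      ∂P) atTop (𝓝 (Real.exp (-(1 - r) * (timeMeasure.prod π B).toReal))) := by
  classical
  let h : ℝ × Y → ℂ := fun p => ((r ^ B.indicator (fun _ => 1) p : ℝ) : ℂ)
  have hm : Measurable h := by
    have : Measurable (B.indicator (fun _ => 1) : ℝ × Y → ℕ) := measurable_const.indicator hB
    exact Complex.measurable_ofReal.comp ((Measurable.of_discrete (f := fun n : ℕ => r ^ n)).comp this)
  have h1 : ∀ p, ‖h p‖ ≤ 1 := fun p => by
    simp only [h, Complex.norm_real]
    rw [Real.norm_of_nonneg (by positivity)]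
    exact pow_le_one₀ hr0 hr1
  have hind : (fun p => h p - 1) = B.indicator fun _ => ((r : ℂ) - 1) := by
    ext p
    by_cases hp : p ∈ B <;> simp [h, hp]
  have key := hD.tendsto_integral_prod hm h1 (by
    rw [hind]
    exact (integrable_indicator_iff hB).2 (integrableOn_const hν))
  rw [hind, integral_indicator_const _ hB] at key
  have hre := (Complex.continuous_re.tendsto _).comp key
  convert hre using 2
  · rename_i n
    simp only [Function.comp_apply, h, hitCount]
    rw [← Complex.ofReal_re (∫ ω, _ ∂P), ← integral_complex_ofReal]
    congr 2
    ext ω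
    rw [← Finset.prod_pow_eq_pow_sum]
    push_cast
    rfl
  · rw [← Complex.ofReal_re (Real.exp _)]
    congr 1
    push_cast
    congr 1
    simp [Measure.real]
    ring

/-- Where the count is infinite, r^count tends to 0 for r < 1. Hence the limit exp(-(1-r)ν(B))
bounds the probability of a finite count from below; then r ↑ 1. -/
theorem ae_lt_top (hD : IsMarkedExpSeq P D Z π) [IsProbabilityMeasure π]
    {B : Set (ℝ × Y)} (hB : MeasurableSet B) (hν : timeMeasure.prod π B ≠ ∞) :
    ∀ᵐ ω ∂P, renewalProcess (D · ω) (Z · ω) B < ∞ := by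
  have := hD.indep.isProbabilityMeasure
  set S : Set Ω := {ω | renewalProcess (D · ω) (Z · ω) B < ∞} with hS
  have hNm : Measurable fun ω => renewalProcess (D · ω) (Z · ω) B :=
    (Measure.measurable_coe hB).comp hD.measurable_renewalProcess
  have hSm : MeasurableSet S := hNm measurableSet_Iio
  have hle : ∀ r : ℝ, 0 ≤ r → r < 1 →
      Real.exp (-(1 - r) * (timeMeasure.prod π B).toReal) ≤ P.real S := by
    intro r hr0 hr1
    have h1 := hD.tendsto_integral_pow_hitCount hB hν hr0 hr1.le
    have hmq : ∀ n, Measurable fun ω =>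
        r ^ hitCount (fun i => (∑ j ∈ Finset.range (i + 1), D j ω, Z i ω)) B n := fun n =>
      (Measurable.of_discrete (f := fun n : ℕ => r ^ n)).comp (hD.measurable_hitCount hB n)
    have h2 : Tendsto (fun n => ∫ ω, Sᶜ.indicator (fun ω =>
        r ^ hitCount (fun i => (∑ j ∈ Finset.range (i + 1), D j ω, Z i ω)) B n) ω ∂P) atTop
        (𝓝 (∫ _, (0 : ℝ) ∂P)) := by
      refine tendsto_integral_of_dominated_convergence (fun _ => 1)
        (fun n => ((hmq n).indicator hSm.compl).aestronglyMeasurable) (integrable_const _)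
        (fun n => ae_of_all _ fun ω => ?_) (ae_of_all _ fun ω => ?_)
      · refine (norm_indicator_le_norm_self _ _).trans ?_
        rw [Real.norm_of_nonneg (by positivity)]
        exact pow_le_one₀ hr0 hr1.le
      · by_cases hω : ω ∈ Sᶜ
        · simp only [indicator_of_mem hω]
          have : renewalProcess (D · ω) (Z · ω) B = ∞ := by simpa [hS] using hω
          exact (tendsto_pow_atTop_nhds_zero_of_lt_one hr0 hr1).comp (tendsto_hitCount_atTop _ hB this)
        · simp only [indicator_of_notMem hω]
          exact tendsto_const_nhds
    rw [integral_zero] at h2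
    have h3 := h2.const_add (P.real S)
    rw [add_zero] at h3
    refine le_of_tendsto_of_tendsto' h1 h3 fun n => ?_
    have hi : Integrable (fun ω =>
        r ^ hitCount (fun i => (∑ j ∈ Finset.range (i + 1), D j ω, Z i ω)) B n) P :=
      (integrable_const (1 : ℝ)).mono' (hmq n).aestronglyMeasurable (ae_of_all _ fun ω => by
        rw [Real.norm_of_nonneg (by positivity)]
        exact pow_le_one₀ hr0 hr1.le)
    rw [← integral_indicator_one hSm, ← integral_add]
    · refine integral_mono hi ?_ fun ω => ?_
      · exact ((integrable_const (1 : ℝ)).indicator hSm).add (hi.indicator hSm.compl)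
      · by_cases hω : ω ∈ S
        · simp [hω]
          exact pow_le_one₀ hr0 hr1.le
        · simp [hω]
    · exact (integrable_const (1 : ℝ)).indicator hSm
    · exact hi.indicator hSm.compl
  have hlim : Tendsto (fun r : ℝ => Real.exp (-(1 - r) * (timeMeasure.prod π B).toReal))
      (𝓝[<] 1) (𝓝 1) := by
    have : Continuous fun r : ℝ => Real.exp (-(1 - r) * (timeMeasure.prod π B).toReal) := by
      fun_prop
    simpa using (this.tendsto 1).mono_left nhdsWithin_le_nhds
  have h1 : 1 ≤ P.real S := by
    refine le_of_tendsto hlim ?_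
    filter_upwards [Ioo_mem_nhdsLT (show (0 : ℝ) < 1 by norm_num)] with r hr
    exact hle r hr.1.le hr.2
  have h2 : P S = 1 := by
    refine le_antisymm prob_le_one ?_
    rw [← ofReal_measureReal (μ := P) (s := S)]
    exact ENNReal.one_le_ofReal.2 h1
  rwa [← prob_compl_eq_zero_iff hSm] at h2

/-- With the convention 2^(-∞) = 0, the expectation of 2^(-N(B)) is at most exp(-ν(B')/2) for every
B' ⊆ B of finite intensity, and ν(B') can be taken arbitrarily large. So this nonnegative variable
vanishes almost surely. -/
theorem ae_eq_top (hD : IsMarkedExpSeq P D Z π) [IsProbabilityMeasure π]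
    {B : Set (ℝ × Y)} (hB : MeasurableSet B) (hν : timeMeasure.prod π B = ∞) :
    ∀ᵐ ω ∂P, renewalProcess (D · ω) (Z · ω) B = ∞ := by
  have := hD.indep.isProbabilityMeasure
  set x : Ω → ℕ → ℝ × Y := fun ω i => (∑ j ∈ Finset.range (i + 1), D j ω, Z i ω) with hx
  have hNm : Measurable fun ω => renewalProcess (D · ω) (Z · ω) B :=
    (Measure.measurable_coe hB).comp hD.measurable_renewalProcess
  let V : Ω → ℝ := {ω | renewalProcess (D · ω) (Z · ω) B < ∞}.indicator fun ω =>
    (2⁻¹ : ℝ) ^ (renewalProcess (D · ω) (Z · ω) B).toReal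
  have hV0 : ∀ ω, 0 ≤ V ω := fun ω => indicator_nonneg (fun _ _ => by positivity) _
  have hVm : Measurable V := by
    refine Measurable.indicator ?_ (hNm measurableSet_Iio)
    exact (measurable_const.pow hNm.ennreal_toReal)
  have hV1 : ∀ ω, V ω ≤ 1 := fun ω => by
    refine indicator_le' (fun _ _ => ?_) (fun _ _ => zero_le_one) ω
    exact Real.rpow_le_one (by norm_num) (by norm_num) ENNReal.toReal_nonneg
  have hVi : Integrable V P := (integrable_const (1 : ℝ)).mono' hVm.aestronglyMeasurable
    (ae_of_all _ fun ω => by rw [Real.norm_of_nonneg (hV0 ω)]; exact hV1 ω)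
  -- Cutting in time suffices for finite intensity, because the mark law is a probability measure.
  let Bk : ℕ → Set (ℝ × Y) := fun k => B ∩ Prod.fst ⁻¹' Iic (k : ℝ)
  have hBk : ∀ k, MeasurableSet (Bk k) := fun k => hB.inter (measurable_fst measurableSet_Iic)
  have hBkν : ∀ k, timeMeasure.prod π (Bk k) ≠ ∞ := fun k => by
    refine ((measure_mono inter_subset_right).trans_lt ?_).ne
    have : (Prod.fst ⁻¹' Iic (k : ℝ) : Set (ℝ × Y)) = Iic (k : ℝ) ×ˢ univ := by ext; simp
    rw [this, Measure.prod_prod, measure_univ, mul_one, timeMeasure,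
      Measure.restrict_apply measurableSet_Iic]
    refine (measure_mono (t := Icc 0 (k : ℝ)) fun t ht => ⟨le_of_lt ht.2, ht.1⟩).trans_lt ?_
    simp
  have hmono : Monotone Bk := fun k l hkl p hp =>
    ⟨hp.1, le_trans (show p.1 ≤ (k : ℝ) from hp.2) (by exact_mod_cast hkl)⟩
  have hlim : Tendsto (fun k => timeMeasure.prod π (Bk k)) atTop (𝓝 ∞) := by
    have h1 := tendsto_measure_iUnion_atTop (μ := timeMeasure.prod π) hmono
    have h2 : ⋃ k, Bk k = B := by
      ext p
      simp only [Bk, mem_iUnion, mem_inter_iff, mem_preimage, mem_Iic, exists_and_left,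
        and_iff_left_iff_imp]
      exact fun _ => exists_nat_ge _
    rwa [h2, hν] at h1
  have hle : ∀ k, ∫ ω, V ω ∂P ≤ Real.exp (-(1 - 2⁻¹) * (timeMeasure.prod π (Bk k)).toReal) := by
    intro k
    refine ge_of_tendsto' (hD.tendsto_integral_pow_hitCount (hBk k) (hBkν k) (r := 2⁻¹)
      (by norm_num) (by norm_num)) fun n => ?_
    refine integral_mono hVi ?_ fun ω => ?_
    · refine (integrable_const (1 : ℝ)).mono'
        ((Measurable.of_discrete (f := fun n : ℕ => (2⁻¹ : ℝ) ^ n)).comp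
          (hD.measurable_hitCount (hBk k) n)).aestronglyMeasurable (ae_of_all _ fun ω => ?_)
      rw [Real.norm_of_nonneg (by positivity)]
      exact pow_le_one₀ (by norm_num) (by norm_num)
    · simp only [V]
      by_cases hω : renewalProcess (D · ω) (Z · ω) B < ∞
      · rw [indicator_of_mem (by exact hω), ← Real.rpow_natCast]
        refine Real.rpow_le_rpow_of_exponent_ge (by norm_num) (by norm_num) ?_
        have h1 := (Nat.cast_le (α := ℝ≥0∞)).2
          (hitCount_mono (x ω) (inter_subset_left : Bk k ⊆ B) n)
        have h2 := ENNReal.toReal_mono hω.ne (h1.trans (hitCount_le (x ω) hB n))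
        simpa using h2
      · rw [indicator_of_notMem (by exact hω)]
        positivity
  have hlim2 : Tendsto (fun k => Real.exp (-(1 - 2⁻¹) * (timeMeasure.prod π (Bk k)).toReal)) atTop
      (𝓝 0) := by
    rw [Real.tendsto_exp_comp_nhds_zero]
    refine Tendsto.const_mul_atTop_of_neg (by norm_num) ?_
    refine tendsto_atTop.2 fun b => ?_
    have := hlim.eventually (lt_mem_nhds (show ENNReal.ofReal b < ∞ from ENNReal.ofReal_lt_top))
    filter_upwards [this] with k hk
    exact (ENNReal.ofReal_le_iff_le_toReal (hBkν k)).1 hk.le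
  have h0 : ∫ ω, V ω ∂P = 0 :=
    le_antisymm (ge_of_tendsto' hlim2 hle) (integral_nonneg hV0)
  rw [integral_eq_zero_iff_of_nonneg hV0 hVi] at h0
  filter_upwards [h0] with ω hω
  by_contra hne
  have hlt : renewalProcess (D · ω) (Z · ω) B < ∞ := lt_top_iff_ne_top.2 hne
  simp only [V, Pi.zero_apply] at hω
  rw [indicator_of_mem (by exact hlt)] at hω
  exact (Real.rpow_pos_of_pos (by norm_num) _).ne' hω

/-- The joint characteristic function of counts in disjoint sets, from the generating functional at
h = exp(i Σ t_j 1_{B_j}). By disjointness h - 1 splits into one term per set, so the exponential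
factorizes: this yields both the Poisson laws and the independence. -/
theorem integral_cexp_sum (hD : IsMarkedExpSeq P D Z π) [IsProbabilityMeasure π]
    {ι : Type*} [Fintype ι] {B : ι → Set (ℝ × Y)} (hB : ∀ i, MeasurableSet (B i))
    (hd : Pairwise fun i j => Disjoint (B i) (B j)) (hν : ∀ i, timeMeasure.prod π (B i) ≠ ∞)
    (t : ι → ℝ) :
    ∫ ω, Complex.exp (((∑ i, t i * (renewalProcess (D · ω) (Z · ω) (B i)).toReal : ℝ) : ℂ) *
      Complex.I) ∂P =
    ∏ i, Complex.exp ((timeMeasure.prod π (B i)).toReal * (Complex.exp (t i * Complex.I) - 1)) := by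
  classical
  have := hD.indep.isProbabilityMeasure
  let f : ℝ × Y → ℝ := fun p => ∑ i, t i * ((B i).indicator (fun _ => 1) p : ℕ)
  let h : ℝ × Y → ℂ := fun p => Complex.exp (f p * Complex.I)
  have hfm : Measurable f := Finset.measurable_sum _ fun i _ => by
    have : Measurable ((B i).indicator (fun _ => 1) : ℝ × Y → ℕ) :=
      measurable_const.indicator (hB i)
    exact ((Measurable.of_discrete (f := fun n : ℕ => (n : ℝ))).comp this).const_mul _
  have hm : Measurable h := by
    have := Complex.measurable_ofReal.comp hfm
    exact Complex.measurable_exp.comp (this.mul_const _)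
  have h1 : ∀ p, ‖h p‖ ≤ 1 := fun p => by simp [h, Complex.norm_exp_ofReal_mul_I]
  have hind : (fun p => h p - 1) =
      fun p => ∑ i, (B i).indicator (fun _ => Complex.exp (t i * Complex.I) - 1) p := by
    ext p
    by_cases hp : ∃ i, p ∈ B i
    · obtain ⟨i, hi⟩ := hp
      have hj : ∀ j, j ≠ i → p ∉ B j := fun j hji hpj => disjoint_left.1 (hd hji) hpj hi
      simp only [h, f]
      rw [Finset.sum_eq_single i (fun j _ hji => by simp [hj j hji]) (by simp),
        Finset.sum_eq_single i (fun j _ hji => by simp [hj j hji]) (by simp)]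
      simp [hi]
    · push Not at hp
      simp [h, f, hp]
  have hint : ∀ i, Integrable ((B i).indicator fun _ => Complex.exp (t i * Complex.I) - 1)
      (timeMeasure.prod π) := fun i =>
    (integrable_indicator_iff (hB i)).2 (integrableOn_const (hν i))
  have key := hD.tendsto_integral_prod hm h1 (by
    rw [hind]
    exact integrable_finsetSum _ fun i _ => hint i)
  rw [hind, integral_finsetSum _ fun i _ => hint i, Complex.exp_sum] at key
  simp_rw [integral_indicator_const _ (hB _)] at key
  have hprod : ∀ n ω, ∏ i ∈ Finset.range n, h (∑ j ∈ Finset.range (i + 1), D j ω, Z i ω) =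
      Complex.exp (((∑ i, t i *
        (hitCount (fun i => (∑ j ∈ Finset.range (i + 1), D j ω, Z i ω)) (B i) n : ℝ) : ℝ) : ℂ) *
        Complex.I) := by
    intro n ω
    simp only [h]
    rw [← Complex.exp_sum, ← Finset.sum_mul, ← Complex.ofReal_sum]
    congr 3
    simp only [f, hitCount]
    rw [Finset.sum_comm]
    push_cast
    simp_rw [Finset.mul_sum]
  simp_rw [hprod] at key
  have hlim : Tendsto (fun n => ∫ ω, Complex.exp (((∑ i, t i *
        (hitCount (fun i => (∑ j ∈ Finset.range (i + 1), D j ω, Z i ω)) (B i) n : ℝ) : ℝ) : ℂ) *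
        Complex.I) ∂P) atTop (𝓝 (∫ ω, Complex.exp (((∑ i, t i *
          (renewalProcess (D · ω) (Z · ω) (B i)).toReal : ℝ) : ℂ) * Complex.I) ∂P)) := by
    refine tendsto_integral_of_dominated_convergence (fun _ => 1) (fun n => ?_)
      (integrable_const _) (fun n => ae_of_all _ fun ω => ?_) ?_
    · have h2 : Measurable fun ω => ∑ i, t i *
        (hitCount (fun i => (∑ j ∈ Finset.range (i + 1), D j ω, Z i ω)) (B i) n : ℝ) :=
        Finset.measurable_sum _ fun i _ => ((Measurable.of_discrete (f := fun n : ℕ => (n : ℝ))).comp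
          (hD.measurable_hitCount (hB i) n)).const_mul _
      exact (Complex.measurable_exp.comp
        ((Complex.measurable_ofReal.comp h2).mul_const _)).aestronglyMeasurable
    · rw [Complex.norm_exp_ofReal_mul_I]
    · have h2 : ∀ᵐ ω ∂P, ∀ i, renewalProcess (D · ω) (Z · ω) (B i) < ∞ :=
        ae_all_iff.2 fun i => hD.ae_lt_top (hB i) (hν i)
      filter_upwards [h2] with ω hω
      have h3 : Tendsto (fun n => ∑ i, t i *
        (hitCount (fun i => (∑ j ∈ Finset.range (i + 1), D j ω, Z i ω)) (B i) n : ℝ)) atTop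
        (𝓝 (∑ i, t i * (renewalProcess (D · ω) (Z · ω) (B i)).toReal)) :=
        tendsto_finsetSum _ fun i _ => (tendsto_hitCount_real _ (hB i) (hω i).ne).const_mul _
      exact (((Complex.continuous_ofReal.tendsto _).comp h3).mul_const _).cexp
  rw [tendsto_nhds_unique hlim key]
  refine Finset.prod_congr rfl fun i _ => ?_
  congr 1

theorem hasLaw_toReal_apply (hD : IsMarkedExpSeq P D Z π) [IsProbabilityMeasure π]
    {B : Set (ℝ × Y)} (hB : MeasurableSet B) (hν : timeMeasure.prod π B ≠ ∞) :
    HasLaw (fun ω => (renewalProcess (D · ω) (Z · ω) B).toReal)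
      ((poissonMeasure (timeMeasure.prod π B).toNNReal).map fun n : ℕ => (n : ℝ)) P := by
  have := hD.indep.isProbabilityMeasure
  have hm : Measurable fun ω => (renewalProcess (D · ω) (Z · ω) B).toReal :=
    ((Measure.measurable_coe hB).comp hD.measurable_renewalProcess).ennreal_toReal
  refine ⟨hm.aemeasurable, ?_⟩
  have := Measure.isProbabilityMeasure_map (μ := P) hm.aemeasurable
  have : IsProbabilityMeasure ((poissonMeasure (timeMeasure.prod π B).toNNReal).map
    fun n : ℕ => (n : ℝ)) := Measure.isProbabilityMeasure_map (by fun_prop)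
  refine Measure.ext_of_charFun ?_
  ext t
  rw [charFun_map_cast_poissonMeasure, charFun_apply, integral_map hm.aemeasurable (by fun_prop)]
  have := hD.integral_cexp_sum (ι := Unit) (B := fun _ => B) (fun _ => hB)
    (fun i j h => absurd (Subsingleton.elim i j) h) (fun _ => hν) fun _ => t
  simpa [mul_comm, ENNReal.toReal] using this

theorem iIndepFun_toReal_apply (hD : IsMarkedExpSeq P D Z π) [IsProbabilityMeasure π]
    {ι : Type*} [Fintype ι] {B : ι → Set (ℝ × Y)} (hB : ∀ i, MeasurableSet (B i))
    (hd : Pairwise fun i j => Disjoint (B i) (B j)) (hν : ∀ i, timeMeasure.prod π (B i) ≠ ∞) :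
    iIndepFun (fun i ω => (renewalProcess (D · ω) (Z · ω) (B i)).toReal) P := by
  have := hD.indep.isProbabilityMeasure
  have hm : ∀ i, Measurable fun ω => (renewalProcess (D · ω) (Z · ω) (B i)).toReal := fun i =>
    ((Measure.measurable_coe (hB i)).comp hD.measurable_renewalProcess).ennreal_toReal
  rw [iIndepFun_iff_charFun_pi fun i => (hm i).aemeasurable]
  intro t
  have hm' : AEMeasurable
      (fun ω => WithLp.toLp 2 fun i => (renewalProcess (D · ω) (Z · ω) (B i)).toReal) P :=
    ((WithLp.measurable_toLp 2 _).comp (measurable_pi_lambda _ hm)).aemeasurable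
  rw [charFun_apply, integral_map hm' (by fun_prop)]
  have := hD.integral_cexp_sum hB hd hν t
  simp_rw [(hD.hasLaw_toReal_apply (hB _) (hν _)).map_eq, charFun_map_cast_poissonMeasure]
  simpa [PiLp.inner_apply, ENNReal.toReal] using this

/-- A renewal process with standard exponential waiting times and i.i.d. marks of law `π` is a
Poisson process with intensity `Leb × π`. -/
theorem isPoissonProcess (hD : IsMarkedExpSeq P D Z π) [IsProbabilityMeasure π] :
    IsPoissonProcess P (fun ω => renewalProcess (D · ω) (Z · ω)) (timeMeasure.prod π) := by
  have := hD.indep.isProbabilityMeasure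
  refine ⟨hD.measurable_renewalProcess, ae_of_all _ fun ω => ⟨ℕ, inferInstance, _, rfl⟩,
    fun B hB hν => ?_, fun B hB hν => hD.ae_eq_top hB hν, fun n B hB hd => ?_⟩
  · have h1 : HasLaw ENNReal.ofReal
        ((poissonMeasure (timeMeasure.prod π B).toNNReal).map fun n : ℕ => (n : ℝ≥0∞))
        ((poissonMeasure (timeMeasure.prod π B).toNNReal).map fun n : ℕ => (n : ℝ)) := by
      refine ⟨by fun_prop, ?_⟩
      rw [Measure.map_map (by fun_prop) (by fun_prop)]
      congr 1
      ext n
      simp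
    refine (h1.comp (hD.hasLaw_toReal_apply hB hν)).congr ?_
    filter_upwards [hD.ae_lt_top hB hν] with ω hω
    exact (ENNReal.ofReal_toReal hω.ne).symm
  · classical
    -- Sets of infinite intensity have an almost surely constant count ∞. They are emptied for the
    -- characteristic-function argument, and `φ` puts the constant back.
    let B' : Fin n → Set (ℝ × Y) := fun i => if timeMeasure.prod π (B i) = ∞ then ∅ else B i
    have hB' : ∀ i, MeasurableSet (B' i) := fun i => by
      simp only [B']; split_ifs
      · exact .empty
      · exact hB i
    have hsub : ∀ i, B' i ⊆ B i := fun i => by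
      simp only [B']; split_ifs
      · exact empty_subset _
      · exact subset_rfl
    have hν' : ∀ i, timeMeasure.prod π (B' i) ≠ ∞ := fun i => by
      simp only [B']; split_ifs with h
      · simp
      · exact h
    have h1 := hD.iIndepFun_toReal_apply hB' (fun i j hij => (hd hij).mono (hsub i) (hsub j)) hν'
    let φ : Fin n → ℝ → ℝ≥0∞ := fun i x =>
      if timeMeasure.prod π (B i) = ∞ then ∞ else ENNReal.ofReal x
    have hφ : ∀ i, Measurable (φ i) := fun i => by
      simp only [φ]; split_ifs <;> fun_prop
    refine (h1.comp φ hφ).congr fun i => ?_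
    by_cases h : timeMeasure.prod π (B i) = ∞
    · filter_upwards [hD.ae_eq_top (hB i) h] with ω hω
      simp [φ, h, hω]
    · filter_upwards [hD.ae_lt_top (hB i) h] with ω hω
      simp [φ, B', h, ENNReal.ofReal_toReal hω.ne]

end IsMarkedExpSeq

end Renewal

/-! ### Measurability of self-normalization -/

section Regularize

variable {X : Type*} [MeasurableSpace X]

open Classical in
/-- The restriction of `m` to `A`, if `j ≤ m A < j + 1`, as a finite kernel. -/
def levelKernel {A : Set X} (hA : MeasurableSet A) (j : ℕ) : Kernel (Measure X) X where
  toFun m := if m A ∈ Ico (j : ℝ≥0∞) (j + 1) then m.restrict A else 0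
  measurable' := Measurable.ite (Measure.measurable_coe hA measurableSet_Ico)
    (Measure.measurable_of_measurable_coe _ fun B hB => by
      simp_rw [Measure.restrict_apply hB]
      exact Measure.measurable_coe (hB.inter hA)) measurable_const

open Classical in
theorem levelKernel_apply {A : Set X} (hA : MeasurableSet A) (j : ℕ) (m : Measure X) :
    levelKernel hA j m = if m A ∈ Ico (j : ℝ≥0∞) (j + 1) then m.restrict A else 0 := rfl

instance {A : Set X} (hA : MeasurableSet A) (j : ℕ) : IsFiniteKernel (levelKernel hA j) := by
  classical
  refine ⟨⟨j + 1, by simp, fun m => ?_⟩⟩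
  rw [levelKernel_apply]
  split_ifs with h
  · simpa using h.2.le
  · simp

variable (ν : Measure X) [SigmaFinite ν]

/-- An s-finite kernel which is the identity on the measures that are finite on the spanning sets
of `ν`. -/
def regularize : Kernel (Measure X) X :=
  Kernel.sum fun p : ℕ × ℕ =>
    levelKernel (MeasurableSet.disjointed (measurableSet_spanningSets ν) p.1) p.2

instance : IsSFiniteKernel (regularize ν) := by
  unfold regularize
  infer_instance

theorem regularize_apply {m : Measure X} (hm : ∀ k, m (spanningSets ν k) < ∞) :
    regularize ν m = m := by
  classical
  have hd := MeasurableSet.disjointed (measurableSet_spanningSets ν)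
  ext B hB
  have h1 : ∀ k, ∑' j, levelKernel (hd k) j m B = m (B ∩ disjointed (spanningSets ν) k) := by
    intro k
    have hk : m (disjointed (spanningSets ν) k) ≠ ∞ :=
      ((measure_mono (disjointed_subset _ k)).trans_lt (hm k)).ne
    set a := m (disjointed (spanningSets ν) k) with ha
    -- Exactly one level is active on each piece, namely the integer part of its mass, so the sum
    -- over levels returns the restriction once.
    have hj : ((⌊a.toReal⌋₊ : ℕ) : ℝ≥0∞) ≤ a ∧ a < (⌊a.toReal⌋₊ : ℕ) + 1 := by
      constructor
      · rw [← ENNReal.ofReal_natCast]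
        exact ENNReal.ofReal_le_of_le_toReal (Nat.floor_le ENNReal.toReal_nonneg)
      · have : ((⌊a.toReal⌋₊ : ℕ) : ℝ≥0∞) + 1 = ENNReal.ofReal ((⌊a.toReal⌋₊ : ℝ) + 1) := by
          rw [ENNReal.ofReal_add (by positivity) zero_le_one]
          simp
        rw [this]
        exact (ENNReal.lt_ofReal_iff_toReal_lt hk).2 (Nat.lt_floor_add_one _)
    rw [tsum_eq_single ⌊a.toReal⌋₊]
    · rw [levelKernel_apply, if_pos (by exact hj), Measure.restrict_apply hB]
    · intro j hne
      rw [levelKernel_apply, if_neg]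
      · rfl
      rintro ⟨h2, h3⟩
      refine hne ?_
      have h4 : (j : ℝ≥0∞) < (⌊a.toReal⌋₊ : ℕ) + 1 := h2.trans_lt hj.2
      have h5 : ((⌊a.toReal⌋₊ : ℕ) : ℝ≥0∞) < j + 1 := hj.1.trans_lt h3
      have h4' : j < ⌊a.toReal⌋₊ + 1 := by exact_mod_cast h4
      have h5' : ⌊a.toReal⌋₊ < j + 1 := by exact_mod_cast h5
      omega
  rw [regularize, Kernel.sum_apply, Measure.sum_apply _ hB,
    ENNReal.tsum_prod (f := fun k j => levelKernel (hd k) j m B)]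
  simp_rw [h1]
  rw [← measure_iUnion (fun i j hij => ((disjoint_disjointed _) hij).mono inter_subset_right
    inter_subset_right) fun k => hB.inter (hd k), ← inter_iUnion, iUnion_disjointed,
    iUnion_spanningSets, inter_univ]

end Regularize

theorem measurable_pointSum : Measurable pointSum :=
  Measure.measurable_lintegral (by fun_prop)

theorem selfNormalize_apply (m : Measure ℝ) {B : Set ℝ} (hB : MeasurableSet B) :
    selfNormalize m B = m {x | x / (pointSum m).toReal ∈ B} := by
  rw [selfNormalize, Measure.map_apply (by fun_prop) hB]
  rfl

theorem upToTime_apply (s : ℝ) (m : Measure (ℝ × ℝ)) {B : Set ℝ} (hB : MeasurableSet B) :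
    upToTime s m B = m {x | x.1 ≤ s ∧ x.2 ∈ B} := by
  rw [upToTime, Measure.map_apply measurable_snd hB, Measure.restrict_apply (measurable_snd hB)]
  congr 1
  ext x
  simp [and_comm]

/-- The set evaluated under m depends on m itself through the total sum. Measurability of such an
evaluation is a property of s-finite kernels applied to jointly measurable sets, which is the
purpose of `regularize`. -/
theorem measurable_selfNormalize_regularize (ν : Measure ℝ) [SigmaFinite ν] :
    Measurable fun m => selfNormalize (regularize ν m) := by
  refine Measure.measurable_of_measurable_coe _ fun B hB => ?_
  simp_rw [selfNormalize_apply _ hB]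
  have hc : Measurable fun p : Measure ℝ × ℝ => p.2 / (pointSum (regularize ν p.1)).toReal := by
    have := (measurable_pointSum.comp (regularize ν).measurable).ennreal_toReal
    exact measurable_snd.div (this.comp measurable_fst)
  have hS : MeasurableSet
      {p : Measure ℝ × ℝ | p.2 / (pointSum (regularize ν p.1)).toReal ∈ B} := hc hB
  have := Kernel.measurable_kernel_prodMk_left (κ := regularize ν) hS
  simpa using this

theorem measurable_upToTime_regularize (ν : Measure (ℝ × ℝ)) [SigmaFinite ν] :
    Measurable fun p : ℝ × Measure (ℝ × ℝ) => upToTime p.1 (regularize ν p.2) := by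
  refine Measure.measurable_of_measurable_coe _ fun B hB => ?_
  simp_rw [upToTime_apply _ _ hB]
  have hS : MeasurableSet
      {q : (ℝ × Measure (ℝ × ℝ)) × (ℝ × ℝ) | q.2.1 ≤ q.1.1 ∧ q.2.2 ∈ B} :=
    (measurableSet_le (f := fun q : (ℝ × Measure (ℝ × ℝ)) × (ℝ × ℝ) => q.2.1)
      (g := fun q => q.1.1) (by fun_prop) (by fun_prop)).inter
      ((measurable_snd.comp measurable_snd) hB)
  have := Kernel.measurable_kernel_prodMk_left
    (κ := (regularize ν).comap (Prod.snd : ℝ × Measure (ℝ × ℝ) → _) measurable_snd) hS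
  simpa using this

/-! ### Laws of self-normalized Poisson processes and of their mixtures -/

section Laws

variable {Ω Ω' X : Type*} [MeasurableSpace Ω] [MeasurableSpace Ω'] [MeasurableSpace X]
  {P : Measure Ω} {P' : Measure Ω'}

theorem IsPoissonProcess.ae_regularize {N : Ω → Measure X} {ν ν' : Measure X} [SigmaFinite ν]
    (hN : IsPoissonProcess P N ν') (h : ∀ k, ν' (spanningSets ν k) ≠ ∞) :
    ∀ᵐ ω ∂P, regularize ν (N ω) = N ω := by
  have : ∀ᵐ ω ∂P, ∀ k, N ω (spanningSets ν k) < ∞ :=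
    ae_all_iff.2 fun k => hN.ae_lt_top (measurableSet_spanningSets ν k) (h k)
  filter_upwards [this] with ω hω using regularize_apply ν hω

theorem IsPoissonProcess.aemeasurable_selfNormalize {N : Ω → Measure ℝ} {ν : Measure ℝ}
    [SigmaFinite ν] (hN : IsPoissonProcess P N ν) :
    AEMeasurable (fun ω => selfNormalize (N ω)) P := by
  refine ⟨_, (measurable_selfNormalize_regularize ν).comp hN.measurable, ?_⟩
  filter_upwards [hN.ae_regularize fun k => (measure_spanningSets_lt_top ν k).ne] with ω hω
  simp only [Function.comp_apply, hω]

theorem IsPoissonProcess.map_selfNormalize_eq {N : Ω → Measure ℝ} {N' : Ω' → Measure ℝ}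
    {ν : Measure ℝ} [SigmaFinite ν] (hN : IsPoissonProcess P N ν) (hN' : IsPoissonProcess P' N' ν) :
    P.map (fun ω => selfNormalize (N ω)) = P'.map (fun ω => selfNormalize (N' ω)) := by
  have h1 : P.map (fun ω => selfNormalize (N ω)) =
      (P.map N).map fun m => selfNormalize (regularize ν m) := by
    rw [Measure.map_map (measurable_selfNormalize_regularize ν) hN.measurable]
    refine Measure.map_congr ?_
    filter_upwards [hN.ae_regularize fun k => (measure_spanningSets_lt_top ν k).ne] with ω hω
    simp only [Function.comp_apply, hω]
  have h2 : P'.map (fun ω => selfNormalize (N' ω)) =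
      (P'.map N').map fun m => selfNormalize (regularize ν m) := by
    rw [Measure.map_map (measurable_selfNormalize_regularize ν) hN'.measurable]
    refine Measure.map_congr ?_
    filter_upwards [hN'.ae_regularize fun k => (measure_spanningSets_lt_top ν k).ne] with ω hω
    simp only [Function.comp_apply, hω]
  rw [h1, h2, map_eq_of_isPoissonProcess hN hN']

variable {E : Type*} [MeasurableSpace E] {Z : Ω → E} {S : Ω → ℝ} {μ : Measure ℝ}
  [IsProbabilityMeasure P]

theorem map_prodMk_of_indepFun (hZ : Measurable Z) (hS : HasLaw S μ P) (hSZ : IndepFun S Z P) :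
    P.map (fun ω => (S ω, Z ω)) = μ.prod (P.map Z) := by
  rw [(indepFun_iff_map_prod_eq_prod_map_map hS.aemeasurable hZ.aemeasurable).1 hSZ, hS.map_eq]

theorem ae_of_indepFun [IsProbabilityMeasure μ] (hZ : Measurable Z) (hS : HasLaw S μ P) (hSZ : IndepFun S Z P)
    {p : ℝ × E → Prop} (hp : MeasurableSet {q | p q})
    (h : ∀ᵐ s ∂μ, ∀ᵐ ω ∂P, p (s, Z ω)) : ∀ᵐ ω ∂P, p (S ω, Z ω) := by
  have hpm := Measure.isProbabilityMeasure_map (μ := P) hZ.aemeasurable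
  refine ae_of_ae_map (f := fun ω => (S ω, Z ω)) (hS.aemeasurable.prodMk hZ.aemeasurable) (p := p) ?_
  rw [map_prodMk_of_indepFun hZ hS hSZ]
  refine (Measure.measure_prod_null hp.compl).2 ?_
  filter_upwards [h] with s hs
  rw [Measure.map_apply hZ (measurable_prodMk_left hp.compl)]
  exact hs

/-- Fubini for the product law of (S, Z). The Poisson property is known only at each fixed s, so the
almost sure finiteness that permits the measurable version `V` must first be carried over to the
random parameter S. -/
theorem mixed_selfNormalize [IsProbabilityMeasure μ] (hZ : Measurable Z) (hS : HasLaw S μ P) (hSZ : IndepFun S Z P)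
    (hμ : ∀ᵐ s ∂μ, 0 < s) {F : ℝ × E → Measure ℝ} (hF : Measurable F) {ν : Measure ℝ}
    [SigmaFinite ν]
    (hN : ∀ s, 0 < s → IsPoissonProcess P (fun ω => F (s, Z ω)) (ENNReal.ofReal s • ν)) :
    AEMeasurable (fun ω => selfNormalize (F (S ω, Z ω))) P ∧
    ∀ A, MeasurableSet A → P.map (fun ω => selfNormalize (F (S ω, Z ω))) A =
      ∫⁻ s, P.map (fun ω => selfNormalize (F (s, Z ω))) A ∂μ := by
  have hpm := Measure.isProbabilityMeasure_map (μ := P) hZ.aemeasurable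
  have hreg : ∀ s, 0 < s → ∀ᵐ ω ∂P, ∀ k, F (s, Z ω) (spanningSets ν k) < ∞ := fun s hs =>
    ae_all_iff.2 fun k => (hN s hs).ae_lt_top (measurableSet_spanningSets ν k)
      (ENNReal.mul_ne_top ENNReal.ofReal_ne_top (measure_spanningSets_lt_top ν k).ne)
  set V : Measure ℝ → Measure ℝ := fun m => selfNormalize (regularize ν m) with hV
  have hVm : Measurable V := measurable_selfNormalize_regularize ν
  have hae : (fun ω => selfNormalize (F (S ω, Z ω))) =ᵐ[P] fun ω => V (F (S ω, Z ω)) := by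
    have := ae_of_indepFun hZ hS hSZ (p := fun q => ∀ k, F q (spanningSets ν k) < ∞)
      (by
        rw [ofPred_forall]
        exact MeasurableSet.iInter fun k =>
          ((Measure.measurable_coe (measurableSet_spanningSets ν k)).comp hF) measurableSet_Iio)
      (by filter_upwards [hμ] with s hs using hreg s hs)
    filter_upwards [this] with ω hω
    simp only [hV, regularize_apply ν hω]
  have hSZm : AEMeasurable (fun ω => (S ω, Z ω)) P := hS.aemeasurable.prodMk hZ.aemeasurable
  refine ⟨((hVm.comp hF).comp_aemeasurable hSZm).congr hae.symm, fun A hA => ?_⟩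
  rw [Measure.map_congr hae]
  have h1 : P.map (fun ω => V (F (S ω, Z ω))) = (P.map fun ω => (S ω, Z ω)).map (V ∘ F) := by
    rw [AEMeasurable.map_map_of_aemeasurable (hVm.comp hF).aemeasurable hSZm]
    rfl
  rw [h1, map_prodMk_of_indepFun hZ hS hSZ, Measure.map_apply (hVm.comp hF) hA,
    Measure.prod_apply ((hVm.comp hF) hA)]
  refine lintegral_congr_ae ?_
  filter_upwards [hμ] with s hs
  rw [Measure.map_apply hZ (measurable_prodMk_left ((hVm.comp hF) hA))]
  have h2 : (fun ω => selfNormalize (F (s, Z ω))) =ᵐ[P] fun ω => V (F (s, Z ω)) := by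
    filter_upwards [hreg s hs] with ω hω
    simp only [hV, regularize_apply ν hω]
  have hFm : Measurable fun ω => V (F (s, Z ω)) :=
    hVm.comp (hF.comp (measurable_const.prodMk hZ))
  rw [Measure.map_congr h2, Measure.map_apply hFm hA]
  rfl

end Laws

/-! ### The stable Lévy measure -/

theorem map_mul_timeMeasure {c : ℝ} (hc : 0 < c) :
    timeMeasure.map (fun x => c * x) = ENNReal.ofReal c⁻¹ • timeMeasure := by
  have h : (fun x : ℝ => c * x) ⁻¹' Ioi 0 = Ioi 0 := by
    ext x; simp [hc]
  have h2 := Measure.restrict_map (μ := (volume : Measure ℝ)) (f := fun x : ℝ => c * x)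
    (by fun_prop) (measurableSet_Ioi (a := (0 : ℝ)))
  rw [h, Real.map_volume_mul_left hc.ne', Measure.restrict_smul, abs_of_pos (inv_pos.2 hc)] at h2
  exact h2.symm

theorem lintegral_comp_mul_timeMeasure {c : ℝ} (hc : 0 < c) {f : ℝ → ℝ≥0∞} (hf : Measurable f) :
    ∫⁻ x, f (c * x) ∂timeMeasure = ENNReal.ofReal c⁻¹ * ∫⁻ x, f x ∂timeMeasure := by
  rw [← lintegral_map hf (by fun_prop), map_mul_timeMeasure hc, lintegral_smul_measure, smul_eq_mul]

theorem ae_pos_timeMeasure : ∀ᵐ t ∂timeMeasure, 0 < t := ae_restrict_mem measurableSet_Ioi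

theorem timeMeasure_Iic {s : ℝ} : timeMeasure (Iic s) = ENNReal.ofReal s := by
  rw [timeMeasure, Measure.restrict_apply measurableSet_Iic, inter_comm, Ioi_inter_Iic]
  simp

theorem map_snd_restrict_prod {Y : Type*} [MeasurableSpace Y] (ν : Measure Y) [SFinite ν] (s : ℝ) :
    ((timeMeasure.prod ν).restrict {x | x.1 ≤ s}).map Prod.snd = ENNReal.ofReal s • ν := by
  have h : {x : ℝ × Y | x.1 ≤ s} = Iic s ×ˢ univ := by ext; simp
  rw [h, ← Measure.prod_restrict, Measure.restrict_univ, Measure.map_snd_prod,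
    Measure.restrict_apply_univ, timeMeasure_Iic]

/-- For a fixed mark y, dividing times by h(y) multiplies Lebesgue measure by h(y). A mark-dependent
change of clock thus turns a probability law of marks into any σ-finite one with positive density
against it. -/
theorem map_div_prod {Y : Type*} [MeasurableSpace Y] (π : Measure Y) [SFinite π] {h : Y → ℝ}
    (hm : Measurable h) (hpos : ∀ᵐ y ∂π, 0 < h y) :
    (timeMeasure.prod π).map (fun p => (p.1 / h p.2, p.2)) =
      timeMeasure.prod (π.withDensity fun y => ENNReal.ofReal (h y)) := by
  have hf : Measurable fun p : ℝ × Y => (p.1 / h p.2, p.2) :=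
    (measurable_fst.div (hm.comp measurable_snd)).prodMk measurable_snd
  ext B hB
  rw [Measure.map_apply hf hB, Measure.prod_apply_symm (hf hB), Measure.prod_apply_symm hB,
    lintegral_withDensity_eq_lintegral_mul _ (by fun_prop) (measurable_measure_prodMk_right hB)]
  refine lintegral_congr_ae ?_
  filter_upwards [hpos] with y hy
  have h1 : (fun t => (t, y)) ⁻¹' ((fun p : ℝ × Y => (p.1 / h p.2, p.2)) ⁻¹' B) =
      (fun t => (h y)⁻¹ * t) ⁻¹' ((fun t => (t, y)) ⁻¹' B) := by
    ext t
    simp [div_eq_inv_mul]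
  rw [h1, ← Measure.map_apply (by fun_prop) (measurable_prodMk_right hB),
    map_mul_timeMeasure (inv_pos.2 hy), inv_inv]
  rfl

theorem stableMeasure_eq (α : ℝ) : stableMeasure α = timeMeasure.withDensity fun x =>
    ENNReal.ofReal (α / Real.Gamma (1 - α) * x ^ (-(α + 1))) := rfl

theorem thinnedMeasure_eq {α : ℝ} (h0 : 0 < α) (h1 : α < 1) :
    thinnedMeasure α = timeMeasure.withDensity fun x =>
    ENNReal.ofReal (α / Real.Gamma (1 - α) * x ^ (-(α + 1)) * Real.exp (-x)) := by
  have hG : 0 < Real.Gamma (1 - α) := Real.Gamma_pos_of_pos (by linarith)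
  rw [thinnedMeasure, stableMeasure_eq, ← withDensity_mul _ (by fun_prop) (by fun_prop)]
  refine withDensity_congr_ae ?_
  filter_upwards [ae_pos_timeMeasure] with x hx
  rw [Pi.mul_apply, ← ENNReal.ofReal_mul (by positivity)]

instance : SigmaFinite timeMeasure := by unfold timeMeasure; infer_instance

instance (α : ℝ) : SigmaFinite (stableMeasure α) := by
  rw [stableMeasure_eq]
  exact SigmaFinite.withDensity_ofReal _

instance (α : ℝ) : SigmaFinite (thinnedMeasure α) :=
  SigmaFinite.withDensity_ofReal _

theorem ae_pos_stableMeasure (α : ℝ) : ∀ᵐ x ∂(stableMeasure α), 0 < x :=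
  (withDensity_absolutelyContinuous _ _).ae_le ae_pos_timeMeasure

theorem ae_pos_thinnedMeasure (α : ℝ) : ∀ᵐ x ∂(thinnedMeasure α), 0 < x :=
  (withDensity_absolutelyContinuous _ _).ae_le (ae_pos_stableMeasure α)

/-- The derivative in u of the Laplace exponent u^α, evaluated as a gamma integral with parameter 1
- α. -/
theorem lintegral_rpow_mul_exp {α : ℝ} (h0 : 0 < α) (h1 : α < 1) {u : ℝ} (hu : 0 < u) :
    ∫⁻ p, ENNReal.ofReal (p * Real.exp (-(u * p))) ∂(stableMeasure α) =
      ENNReal.ofReal (α * u ^ (α - 1)) := by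
  have hG : 0 < Real.Gamma (1 - α) := Real.Gamma_pos_of_pos (by linarith)
  rw [stableMeasure_eq, lintegral_withDensity_eq_lintegral_mul _ (by fun_prop) (by fun_prop)]
  have h2 : ∫⁻ p, ((fun x => ENNReal.ofReal (α / Real.Gamma (1 - α) * x ^ (-(α + 1)))) *
      fun p => ENNReal.ofReal (p * Real.exp (-(u * p)))) p ∂timeMeasure =
      ∫⁻ p in Ioi 0, ENNReal.ofReal (α / Real.Gamma (1 - α) *
        (p ^ ((1 - α) - 1) * Real.exp (-(u * p)))) := by
    refine lintegral_congr_ae ?_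
    filter_upwards [ae_pos_timeMeasure] with p hp
    rw [Pi.mul_apply, ← ENNReal.ofReal_mul (by positivity)]
    congr 1
    rw [show (1 - α) - 1 = -(α + 1) + 1 by ring, Real.rpow_add_one hp.ne']
    ring
  have hint : IntegrableOn (fun p : ℝ => p ^ ((1 - α) - 1) * Real.exp (-(u * p))) (Ioi 0) := by
    -- A non-integrable function would have integral 0 by convention, against the positive value
    -- given by the gamma formula.
    by_contra hn
    have h3 := Real.integral_rpow_mul_exp_neg_mul_Ioi (a := 1 - α) (by linarith) hu
    rw [integral_undef hn] at h3
    have : 0 < (1 / u) ^ (1 - α) * Real.Gamma (1 - α) := by positivity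
    linarith
  rw [h2, ← ofReal_integral_eq_lintegral_ofReal (hint.const_mul _), integral_const_mul,
    Real.integral_rpow_mul_exp_neg_mul_Ioi (by linarith) hu]
  · congr 1
    rw [one_div, Real.inv_rpow hu.le, ← Real.rpow_neg hu.le, neg_sub]
    field_simp
  · filter_upwards [ae_restrict_mem measurableSet_Ioi] with p hp
    have : 0 < p := hp
    positivity

theorem lintegral_thinnedMeasure {α : ℝ} (h0 : 0 < α) (h1 : α < 1) :
    ∫⁻ x, ENNReal.ofReal x ∂(thinnedMeasure α) = ENNReal.ofReal α := by
  have := lintegral_rpow_mul_exp h0 h1 one_pos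
  rw [Real.one_rpow, mul_one] at this
  rw [← this, thinnedMeasure, lintegral_withDensity_eq_lintegral_mul _ (by fun_prop) (by fun_prop)]
  refine lintegral_congr fun x => ?_
  rw [Pi.mul_apply, ← ENNReal.ofReal_mul (Real.exp_pos _).le, one_mul, mul_comm]

theorem expMeasure_Ioi {a : ℝ} (ha : 0 ≤ a) :
    expMeasure 1 (Ioi a) = ENNReal.ofReal (Real.exp (-a)) := by
  rw [← expMeasure_Ici ha]
  refine measure_congr ?_
  have hac : expMeasure 1 ≪ volume := withDensity_absolutelyContinuous _ _
  exact hac.ae_eq Ioi_ae_eq_Ici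

theorem expMeasure_Iic {a : ℝ} (ha : 0 ≤ a) :
    expMeasure 1 (Iic a) = ENNReal.ofReal (1 - Real.exp (-a)) := by
  rw [← compl_Ioi, prob_compl_eq_one_sub measurableSet_Ioi, expMeasure_Ioi ha,
    ENNReal.ofReal_sub _ (Real.exp_pos _).le, ENNReal.ofReal_one]

/-- Laplace exponent of the stable subordinator: 1 - exp(-zp) is the integral of p exp(-up) over u
in (0, z], and Tonelli reduces to α ∫ u^(α-1) du. -/
theorem lintegral_one_sub_exp {α : ℝ} (h0 : 0 < α) (h1 : α < 1) {z : ℝ} (hz : 0 ≤ z) :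
    ∫⁻ p, ENNReal.ofReal (1 - Real.exp (-(z * p))) ∂(stableMeasure α) =
      ENNReal.ofReal (z ^ α) := by
  have h2 : ∀ p : ℝ, 0 < p → ENNReal.ofReal (1 - Real.exp (-(z * p))) =
      ∫⁻ u in Ioc 0 z, ENNReal.ofReal (p * Real.exp (-(u * p))) := by
    intro p hp
    have hc : Continuous fun u : ℝ => p * Real.exp (-(u * p)) := by fun_prop
    rw [← ofReal_integral_eq_lintegral_ofReal (hc.integrableOn_Ioc)
      (ae_of_all _ fun u => by positivity), ← intervalIntegral.integral_of_le hz]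
    congr 1
    have hd : ∀ u ∈ uIcc 0 z, HasDerivAt (fun u : ℝ => -Real.exp (-(u * p)))
        (p * Real.exp (-(u * p))) u := fun u _ => by
      have := (((hasDerivAt_id u).mul_const p).neg.exp).neg
      refine this.congr_deriv ?_
      simp only [id, one_mul, Pi.neg_apply]
      ring
    rw [intervalIntegral.integral_eq_sub_of_hasDerivAt hd (hc.intervalIntegrable _ _)]
    simp
    ring
  rw [lintegral_congr_ae (by filter_upwards [ae_pos_stableMeasure α] with p hp using h2 p hp),
    lintegral_lintegral_swap (by fun_prop)]
  have h3 : ∫⁻ u in Ioc 0 z, ∫⁻ p, ENNReal.ofReal (p * Real.exp (-(u * p))) ∂(stableMeasure α) =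
      ∫⁻ u in Ioc 0 z, ENNReal.ofReal (α * u ^ (α - 1)) := by
    refine setLIntegral_congr_fun measurableSet_Ioc fun u hu => ?_
    exact lintegral_rpow_mul_exp h0 h1 hu.1
  have hi : IntervalIntegrable (fun u : ℝ => u ^ (α - 1)) volume 0 z :=
    intervalIntegral.intervalIntegrable_rpow' (by linarith)
  rw [h3, ← ofReal_integral_eq_lintegral_ofReal, ← intervalIntegral.integral_of_le hz,
    intervalIntegral.integral_const_mul, integral_rpow (Or.inl (by linarith))]
  · congr 1
    rw [sub_add_cancel, Real.zero_rpow h0.ne']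
    field_simp
    ring
  · exact ((intervalIntegrable_iff_integrableOn_Ioc_of_le hz).1 hi).const_mul _
  · filter_upwards [ae_restrict_mem measurableSet_Ioc] with u hu
    have := hu.1
    positivity

/-- A point p has exponential mark at most zp with probability 1 - exp(-zp). For the Poisson process
this makes exp(-z^α) the probability of having no ratio up to z. -/
theorem stable_prod_exp_le {α : ℝ} (h0 : 0 < α) (h1 : α < 1) {z : ℝ} (hz : 0 ≤ z) :
    (stableMeasure α).prod (expMeasure 1) {q | q.2 / q.1 ≤ z} = ENNReal.ofReal (z ^ α) := by
  have hm : MeasurableSet {q : ℝ × ℝ | q.2 / q.1 ≤ z} :=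
    measurableSet_le (by fun_prop) (by fun_prop)
  rw [Measure.prod_apply hm, ← lintegral_one_sub_exp h0 h1 hz]
  refine lintegral_congr_ae ?_
  filter_upwards [ae_pos_stableMeasure α] with p hp
  rw [← expMeasure_Iic (by positivity)]
  congr 1
  ext e
  simp [div_le_iff₀ hp]

/-- A point p keeps a ratio above z with probability exp(-zp). In the variable x = zp this is the
factor e^(-x), while the power density contributes z^(α+1) and the change of variable 1/z. -/
theorem map_restrict_stable_prod_exp {α : ℝ} (h0 : 0 < α) (h1 : α < 1) {z : ℝ} (hz : 0 < z) :
    (((stableMeasure α).prod (expMeasure 1)).restrict {q | z < q.2 / q.1}).map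
      (fun q => z * q.1) = ENNReal.ofReal (z ^ α) • thinnedMeasure α := by
  have hG : 0 < Real.Gamma (1 - α) := Real.Gamma_pos_of_pos (by linarith)
  have hm : MeasurableSet {q : ℝ × ℝ | z < q.2 / q.1} :=
    measurableSet_lt (by fun_prop) (by fun_prop)
  have hf : Measurable fun q : ℝ × ℝ => z * q.1 := by fun_prop
  ext B hB
  rw [Measure.map_apply hf hB, Measure.restrict_apply (hf hB), Measure.prod_apply ((hf hB).inter hm),
    thinnedMeasure_eq h0 h1, Measure.smul_apply, withDensity_apply _ hB,
    ← lintegral_indicator hB, stableMeasure_eq]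
  let φ : ℝ → ℝ≥0∞ := B.indicator fun x =>
    ENNReal.ofReal (α / Real.Gamma (1 - α) * x ^ (-(α + 1)) * Real.exp (-x))
  have hφ : Measurable φ := Measurable.indicator (by fun_prop) hB
  rw [lintegral_withDensity_eq_lintegral_mul _ (by fun_prop)
    (measurable_measure_prodMk_left ((hf hB).inter hm))]
  have h2 : ∀ᵐ p ∂timeMeasure,
      ((fun x => ENNReal.ofReal (α / Real.Gamma (1 - α) * x ^ (-(α + 1)))) * fun p =>
        expMeasure 1 (Prod.mk p ⁻¹' ((fun q : ℝ × ℝ => z * q.1) ⁻¹' B ∩ {q | z < q.2 / q.1}))) p =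
      ENNReal.ofReal (z ^ (α + 1)) * φ (z * p) := by
    filter_upwards [ae_pos_timeMeasure] with p hp
    rw [Pi.mul_apply]
    by_cases hB' : z * p ∈ B
    · have : Prod.mk p ⁻¹' ((fun q : ℝ × ℝ => z * q.1) ⁻¹' B ∩ {q | z < q.2 / q.1}) =
          Ioi (z * p) := by
        ext e
        simp [hB', lt_div_iff₀ hp]
      rw [this, expMeasure_Ioi (by positivity)]
      simp only [φ, indicator_of_mem hB']
      rw [← ENNReal.ofReal_mul (by positivity), ← ENNReal.ofReal_mul (by positivity)]
      congr 1
      rw [Real.mul_rpow hz.le hp.le, Real.rpow_neg hz.le]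
      have : z ^ (α + 1) ≠ 0 := by positivity
      field_simp
    · have : Prod.mk p ⁻¹' ((fun q : ℝ × ℝ => z * q.1) ⁻¹' B ∩ {q | z < q.2 / q.1}) = ∅ := by
        ext e
        simp [hB']
      simp [φ, hB', this]
  rw [lintegral_congr_ae h2, lintegral_const_mul _ (by fun_prop), lintegral_comp_mul_timeMeasure hz hφ,
    ← mul_assoc, ← ENNReal.ofReal_mul (by positivity), smul_eq_mul]
  congr 2
  rw [Real.rpow_add_one hz.ne']
  field_simp

/-- Write the image as g / u(t) with u(t) = ((s+t)/s)^(1/α). For fixed t its density at y is u(t)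
times the gamma density at y u(t). Since u' = u^(1-α)/(αs), this is a constant multiple, depending
on y, of u'(t) exp(-y u(t)), so the integral over t is elementary. -/
theorem map_mixedGamma {α : ℝ} (h0 : 0 < α) (h1 : α < 1) {s : ℝ} (hs : 0 < s) :
    (timeMeasure.prod (gammaMeasure (1 - α) 1)).map
      (fun p => p.2 * (s / (s + p.1)) ^ (1 / α)) = ENNReal.ofReal s • thinnedMeasure α := by
  have := isProbabilityMeasure_gammaMeasure (a := 1 - α) (r := 1) (by linarith) one_pos
  have hG : 0 < Real.Gamma (1 - α) := Real.Gamma_pos_of_pos (by linarith)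
  have hf : Measurable fun p : ℝ × ℝ => p.2 * (s / (s + p.1)) ^ (1 / α) := by fun_prop
  let u : ℝ → ℝ := fun t => ((s + t) / s) ^ (1 / α)
  have hum : Measurable u := by fun_prop
  have hu : ∀ t, 0 < t → 0 < u t := fun t ht => by positivity
  let g : ℝ → ℝ := fun x => x ^ (-α) * Real.exp (-x) / Real.Gamma (1 - α)
  have hgm : Measurable g := by fun_prop
  have hgamma : gammaMeasure (1 - α) 1 = timeMeasure.withDensity fun x => ENNReal.ofReal (g x) := by
    rw [gammaMeasure_eq_withDensity, show (1 - α) - 1 = -α by ring]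
    rfl
  ext B hB
  rw [Measure.map_apply hf hB, Measure.prod_apply (hf hB),
    thinnedMeasure_eq h0 h1, Measure.smul_apply, withDensity_apply _ hB,
    ← lintegral_indicator hB]
  have h2 : ∀ᵐ t ∂timeMeasure, gammaMeasure (1 - α) 1
      (Prod.mk t ⁻¹' ((fun p : ℝ × ℝ => p.2 * (s / (s + p.1)) ^ (1 / α)) ⁻¹' B)) =
      ∫⁻ y, B.indicator (fun y => ENNReal.ofReal (u t * g (y * u t))) y ∂timeMeasure := by
    filter_upwards [ae_pos_timeMeasure] with t ht
    have hut := hu t ht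
    have hr : (s / (s + t)) ^ (1 / α) = (u t)⁻¹ := by
      simp only [u]
      rw [← Real.inv_rpow (by positivity), inv_div]
    rw [hgamma, withDensity_apply _ (measurable_prodMk_left (hf hB)),
      ← lintegral_indicator (measurable_prodMk_left (hf hB))]
    have h3 := lintegral_comp_mul_timeMeasure (inv_pos.2 hut)
      (f := B.indicator (fun y => ENNReal.ofReal (g (y * u t))))
      (Measurable.indicator (by fun_prop) hB)
    have h4 : ∀ y, B.indicator (fun y => ENNReal.ofReal (u t * g (y * u t))) y =
        ENNReal.ofReal (u t) * B.indicator (fun y => ENNReal.ofReal (g (y * u t))) y := by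
      intro y
      by_cases hy : y ∈ B
      · simp [hy, ENNReal.ofReal_mul hut.le]
      · simp [hy]
    simp_rw [h4]
    rw [lintegral_const_mul _ (Measurable.indicator (by fun_prop) hB)]
    rw [inv_inv] at h3
    rw [← h3]
    refine lintegral_congr fun x => ?_
    have hx : (u t)⁻¹ * x * u t = x := by field_simp
    by_cases hxB : (u t)⁻¹ * x ∈ B
    · rw [indicator_of_mem hxB, indicator_of_mem, hx]
      simp only [mem_preimage]
      rwa [hr, mul_comm]
    · rw [indicator_of_notMem hxB, indicator_of_notMem]
      simp only [mem_preimage]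
      rwa [hr, mul_comm]
  rw [lintegral_congr_ae h2, lintegral_lintegral_swap, smul_eq_mul, ← lintegral_const_mul _
    (Measurable.indicator (by fun_prop) hB)]
  · refine lintegral_congr_ae ?_
    filter_upwards [ae_pos_timeMeasure] with y hy
    by_cases hyB : y ∈ B
    · simp only [indicator_of_mem hyB]
      -- The primitive in t: it vanishes at infinity, and as u(0) = 1, its negative at 0 is s times
      -- the density of the thinned measure at y.
      let H : ℝ → ℝ := fun t => -(α * s / y * (y ^ (-α) / Real.Gamma (1 - α))) * Real.exp (-(y * u t))
      have hder : ∀ t ∈ Ici (0 : ℝ), HasDerivAt H (u t * g (y * u t)) t := by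
        intro t ht
        have ht' : 0 < (s + t) / s := by have : 0 ≤ t := ht; positivity
        have hut : 0 < u t := by positivity
        have hd1 : HasDerivAt (fun t => (s + t) / s) (1 / s) t :=
          ((hasDerivAt_id t).const_add s).div_const s
        have hd2 : HasDerivAt u (1 / s * (1 / α) * ((s + t) / s) ^ (1 / α - 1)) t :=
          hd1.rpow_const (Or.inl ht'.ne')
        have hd3 := ((hd2.const_mul y).neg.exp).const_mul
          (-(α * s / y * (y ^ (-α) / Real.Gamma (1 - α))))
        refine hd3.congr_deriv ?_
        have e1 : ((s + t) / s) ^ (1 / α - 1) = u t * (u t) ^ (-α) := by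
          simp only [u]
          rw [← Real.rpow_mul ht'.le, ← Real.rpow_add ht']
          congr 1
          field_simp
          ring
        rw [e1]
        simp only [g]
        rw [Real.mul_rpow hy.le hut.le]
        field_simp
        simp only [Pi.neg_apply]
      have hpos : ∀ t ∈ Ioi (0 : ℝ), 0 ≤ u t * g (y * u t) := fun t ht => by
        have := hu t ht
        positivity
      have hlim : Tendsto H atTop (𝓝 0) := by
        have h5 : Tendsto u atTop atTop :=
          (tendsto_rpow_atTop (by positivity)).comp
            ((tendsto_atTop_add_const_left _ s tendsto_id).atTop_div_const hs)
        have h6 : Tendsto (fun t => Real.exp (-(y * u t))) atTop (𝓝 0) :=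
          Real.tendsto_exp_neg_atTop_nhds_zero.comp (h5.const_mul_atTop hy)
        simpa only [mul_zero] using h6.const_mul (-(α * s / y * (y ^ (-α) / Real.Gamma (1 - α))))
      have hi := integrableOn_Ioi_deriv_of_nonneg' hder hpos hlim
      have hI := integral_Ioi_of_hasDerivAt_of_nonneg' hder hpos hlim
      change ∫⁻ t in Ioi 0, ENNReal.ofReal (u t * g (y * u t)) = _
      rw [← ofReal_integral_eq_lintegral_ofReal hi
        (by filter_upwards [ae_restrict_mem measurableSet_Ioi] with t ht using hpos t ht), hI,
        ← ENNReal.ofReal_mul hs.le]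
      congr 1
      have hu0 : u 0 = 1 := by simp [u, hs.ne']
      simp only [H, hu0, mul_one]
      rw [show -(α + 1) = -α - 1 by ring, Real.rpow_sub_one hy.ne']
      field_simp
      ring
    · simp [hyB]
  · refine Measurable.aemeasurable ?_
    have : (Function.uncurry fun t y => B.indicator (fun y => ENNReal.ofReal (u t * g (y * u t))) y) =
        (Prod.snd ⁻¹' B).indicator fun p : ℝ × ℝ => ENNReal.ofReal (u p.1 * g (p.2 * u p.1)) := by
      ext p
      by_cases hp : p.2 ∈ B <;> simp [Function.uncurry, Set.indicator, hp]
    rw [this]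
    exact Measurable.indicator (by fun_prop) (measurable_snd hB)

/-- Read off from the image representation at s = 1: pushing forward preserves total mass, and Leb ×
gamma has infinite mass. -/
theorem thinnedMeasure_univ {α : ℝ} (h0 : 0 < α) (h1 : α < 1) : thinnedMeasure α univ = ∞ := by
  have := isProbabilityMeasure_gammaMeasure (a := 1 - α) (r := 1) (by linarith) one_pos
  have h := congrArg (fun m => m univ) (map_mixedGamma h0 h1 one_pos)
  simp only [ENNReal.ofReal_one, one_smul] at h
  rw [← h, Measure.map_apply (by fun_prop) .univ, preimage_univ, ← univ_prod_univ,
    Measure.prod_prod, measure_univ (μ := gammaMeasure (1 - α) 1), mul_one, timeMeasure]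
  simp

/-- The function α e^x / x is the density of μ_α with respect to gamma(1-α, 1), so the change of
clock replaces that mark law by μ_α. -/
theorem map_div_gamma_prod_exp {α : ℝ} (h0 : 0 < α) (h1 : α < 1) :
    (timeMeasure.prod ((gammaMeasure (1 - α) 1).prod (expMeasure 1))).map
      (fun p => (p.1 / (α * Real.exp p.2.1 / p.2.1), p.2)) = markedIntensity α := by
  have := isProbabilityMeasure_gammaMeasure (a := 1 - α) (r := 1) (by linarith) one_pos
  have hG : 0 < Real.Gamma (1 - α) := Real.Gamma_pos_of_pos (by linarith)
  have hgp : ∀ᵐ x ∂(gammaMeasure (1 - α) 1), 0 < x := by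
    rw [gammaMeasure_eq_withDensity]
    exact (withDensity_absolutelyContinuous _ _).ae_le ae_pos_timeMeasure
  have hpos : ∀ᵐ y : ℝ × ℝ ∂((gammaMeasure (1 - α) 1).prod (expMeasure 1)),
      0 < α * Real.exp y.1 / y.1 := by
    filter_upwards [Measure.quasiMeasurePreserving_fst.ae hgp] with y hy
    positivity
  refine (map_div_prod ((gammaMeasure (1 - α) 1).prod (expMeasure 1))
    (h := fun y : ℝ × ℝ => α * Real.exp y.1 / y.1) (by fun_prop) hpos).trans ?_
  · rw [markedIntensity]
    congr 1
    have h2 : (gammaMeasure (1 - α) 1).withDensity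
        (fun x => ENNReal.ofReal (α * Real.exp x / x)) = stableMeasure α := by
      rw [gammaMeasure_eq_withDensity, ← withDensity_mul _ (by fun_prop) (by fun_prop),
        stableMeasure_eq]
      refine withDensity_congr_ae ?_
      filter_upwards [ae_pos_timeMeasure] with x hx
      rw [Pi.mul_apply, ← ENNReal.ofReal_mul (by positivity)]
      congr 1
      rw [show (1 - α) - 1 = -(α + 1) + 1 by ring, Real.rpow_add_one hx.ne', Real.exp_neg]
      field_simp
    rw [← h2, prod_withDensity_left (by fun_prop)]

/-! ### The size-biased points of the stable process -/

section FirstPoint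

variable {Ω : Type*} [MeasurableSpace Ω] {P : Measure Ω}

theorem IsPoissonProcess.congr {X : Type*} [MeasurableSpace X] {N N' : Ω → Measure X}
    {ν : Measure X} (hN : IsPoissonProcess P N ν) (hm : Measurable N') (h : N =ᵐ[P] N') :
    IsPoissonProcess P N' ν := by
  have hB : ∀ B : Set X, (fun ω => N ω B) =ᵐ[P] fun ω => N' ω B := fun B => by
    filter_upwards [h] with ω hω
    rw [hω]
  refine ⟨hm, ?_, fun B hBm hν => (hN.poisson B hBm hν).congr (hB B).symm, fun B hBm hν => ?_,
    fun n B hBm hd => (hN.indep n B hBm hd).congr fun i => hB (B i)⟩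
  · filter_upwards [hN.counting, h] with ω h1 h2
    rwa [← h2]
  · filter_upwards [hN.infinite B hBm hν, h] with ω h1 h2
    rwa [← h2]

/-- Supplies the probability space that the definition of PD(α, θ) asks for: a renewal process with
i.i.d. gamma and exponential marks, followed by the mark-dependent change of clock. -/
theorem exists_isPoissonProcess_markedIntensity {α : ℝ} (h0 : 0 < α) (h1 : α < 1) :
    ∃ (Ω : Type) (_ : MeasurableSpace Ω) (P : Measure Ω) (_ : IsProbabilityMeasure P)
      (N : Ω → Measure (ℝ × ℝ × ℝ)), IsPoissonProcess P N (markedIntensity α) := by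
  have := isProbabilityMeasure_gammaMeasure (a := 1 - α) (r := 1) (by linarith) one_pos
  have hM : IsMarkedExpSeq
      (Measure.infinitePi fun _ : ℕ => (expMeasure 1).prod ((gammaMeasure (1 - α) 1).prod
        (expMeasure 1)))
      (fun i (ω : ℕ → ℝ × ℝ × ℝ) => (ω i).1) (fun i ω => (ω i).2)
      ((gammaMeasure (1 - α) 1).prod (expMeasure 1)) := by
    refine ⟨fun i => by fun_prop, fun i => by fun_prop, ?_, fun i => ?_⟩
    · exact iIndepFun_infinitePi (X := fun _ x => x) fun _ => measurable_id
    · exact (measurePreserving_eval_infinitePi (fun _ : ℕ => (expMeasure 1).prod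
        ((gammaMeasure (1 - α) 1).prod (expMeasure 1))) i).hasLaw
  have hP := hM.isPoissonProcess.map
    (f := fun p : ℝ × ℝ × ℝ => (p.1 / (α * Real.exp p.2.1 / p.2.1), p.2)) (by fun_prop)
  rw [map_div_gamma_prod_exp h0 h1] at hP
  exact ⟨_, _, _, inferInstance, _, hP⟩

/-- The pairs `(p, e)` with `e / p ≤ z`. -/
def ratioLe (z : ℝ) : Set (ℝ × ℝ) := {q | q.2 / q.1 ≤ z}

theorem measurableSet_ratioLe (z : ℝ) : MeasurableSet (ratioLe z) :=
  measurableSet_le (by fun_prop) (by fun_prop)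

theorem compl_ratioLe (z : ℝ) : (ratioLe z)ᶜ = {q | z < q.2 / q.1} := by
  ext q
  simp [ratioLe]

/-- The smallest ratio `e / p` of the points `(p, e)` of a point measure. -/
def firstRatio (m : Measure (ℝ × ℝ)) : ℝ := sInf {z : ℝ | m (ratioLe z) ≠ 0}

variable {m : Measure (ℝ × ℝ)}

theorem ratioLe_mono {y z : ℝ} (h : y ≤ z) : ratioLe y ⊆ ratioLe z := fun _ hq => le_trans hq h

/-- The two hypotheses make the set of levels bounded below and nonempty, so that `sInf` is a
genuine infimum and not a default value. -/
theorem firstRatio_bounds (hm : m (ratioLe 0) = 0) (hm' : ∃ n : ℕ, m (ratioLe n) ≠ 0) :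
    (∀ z ∈ {z : ℝ | m (ratioLe z) ≠ 0}, firstRatio m ≤ z) ∧
      (∀ z, m (ratioLe z) = 0 → z ≤ firstRatio m) := by
  have hlb : ∀ z, m (ratioLe z) = 0 → ∀ y ∈ {z : ℝ | m (ratioLe z) ≠ 0}, z ≤ y := by
    intro z hz y hy
    by_contra! h
    exact hy (measure_mono_null (ratioLe_mono h.le) hz)
  obtain ⟨n, hn⟩ := hm'
  exact ⟨fun z hz => csInf_le ⟨0, hlb 0 hm⟩ hz, fun z hz => le_csInf ⟨n, hn⟩ (hlb z hz)⟩

theorem ae_firstRatio_bounds {α : ℝ} (h0 : 0 < α) (h1 : α < 1) [IsProbabilityMeasure P]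
    {M : Ω → Measure (ℝ × ℝ)}
    (hM : IsPoissonProcess P M ((stableMeasure α).prod (expMeasure 1))) :
    ∀ᵐ ω ∂P, M ω (ratioLe 0) = 0 ∧ ∃ n : ℕ, M ω (ratioLe n) ≠ 0 := by
  have h2 : ∀ᵐ ω ∂P, M ω (ratioLe 0) = 0 := by
    refine hM.ae_eq_zero (measurableSet_ratioLe 0) ?_
    rw [ratioLe, stable_prod_exp_le h0 h1 le_rfl, Real.zero_rpow h0.ne', ENNReal.ofReal_zero]
  have h3 : ∀ n : ℕ, P {ω | M ω (ratioLe n) = 0} = ENNReal.ofReal (Real.exp (-((n : ℝ) ^ α))) := by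
    intro n
    have := stable_prod_exp_le h0 h1 n.cast_nonneg
    rw [hM.measure_eq_zero (measurableSet_ratioLe n) (by rw [ratioLe, this]; simp), ratioLe, this,
      ENNReal.toReal_ofReal (by positivity)]
  have h4 : P {ω | ∀ n : ℕ, M ω (ratioLe n) = 0} = 0 := by
    have hlim : Tendsto (fun n : ℕ => ENNReal.ofReal (Real.exp (-((n : ℝ) ^ α)))) atTop (𝓝 0) := by
      rw [← ENNReal.ofReal_zero]
      exact ENNReal.tendsto_ofReal (Real.tendsto_exp_neg_atTop_nhds_zero.comp
        ((tendsto_rpow_atTop h0).comp tendsto_natCast_atTop_atTop))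
    refine le_antisymm (ge_of_tendsto' hlim fun n => ?_) zero_le
    rw [← h3]
    exact measure_mono fun ω hω => hω n
  filter_upwards [h2, measure_eq_zero_iff_ae_notMem.1 h4] with ω h5 h6
  refine ⟨h5, ?_⟩
  by_contra! h
  exact h6 h

theorem aemeasurable_firstRatio {M : Ω → Measure (ℝ × ℝ)} (hM : Measurable M)
    (h : ∀ᵐ ω ∂P, M ω (ratioLe 0) = 0 ∧ ∃ n : ℕ, M ω (ratioLe n) ≠ 0) :
    AEMeasurable (fun ω => firstRatio (M ω)) P := by
  classical
  -- Rational levels are enough for the infimum, and ∞ discards those without a point; this exhibits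
  -- a measurable version.
  refine ⟨fun ω => (⨅ q : ℚ, if M ω (ratioLe q) = 0 then ∞ else ENNReal.ofReal q).toReal, ?_, ?_⟩
  · refine (Measurable.iInf fun q => Measurable.ite ?_ measurable_const
      measurable_const).ennreal_toReal
    exact ((Measure.measurable_coe (measurableSet_ratioLe q)).comp hM) (measurableSet_singleton 0)
  filter_upwards [h] with ω ⟨h1, h2⟩
  obtain ⟨h3, h4⟩ := firstRatio_bounds h1 h2
  have h5 : ⨅ q : ℚ, (if M ω (ratioLe q) = 0 then ∞ else ENNReal.ofReal q) =
      ENNReal.ofReal (firstRatio (M ω)) := by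
    refine le_antisymm (le_of_forall_gt fun c hc => ?_) (le_iInf fun q => ?_)
    · obtain ⟨q, hq, hq0, hqc⟩ : ∃ q : ℚ, firstRatio (M ω) < q ∧ True ∧
          ENNReal.ofReal q < c := by
        rcases eq_or_ne c ∞ with rfl | hct
        · obtain ⟨q, hq⟩ := exists_rat_gt (firstRatio (M ω))
          exact ⟨q, hq, trivial, ENNReal.ofReal_lt_top⟩
        · obtain ⟨q, hq, hq'⟩ := exists_rat_btwn ((ENNReal.ofReal_lt_iff_lt_toReal (h4 0 h1) hct).1 hc)
          exact ⟨q, hq, trivial,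
            (ENNReal.ofReal_lt_iff_lt_toReal ((h4 0 h1).trans hq.le) hct).2 hq'⟩
      refine (iInf_le _ q).trans_lt ?_
      rwa [if_neg fun h => (h4 q h).not_gt hq]
    · split_ifs with hq
      · exact le_top
      · exact ENNReal.ofReal_le_ofReal (h3 q hq)
  rw [h5, ENNReal.toReal_ofReal (h4 0 h1)]

/-- Layer cake in its strict and its weak form. Almost surely Z > t implies that no ratio is ≤ t,
which implies Z ≥ t, so the two forms squeeze the integral and attainment of the infimum is never
needed. -/
theorem lintegral_firstRatio_rpow {α θ : ℝ} (h0 : 0 < α) (h1 : α < 1) (hθ : 0 < θ)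
    [IsProbabilityMeasure P] {M : Ω → Measure (ℝ × ℝ)}
    (hM : IsPoissonProcess P M ((stableMeasure α).prod (expMeasure 1))) (A : Set Ω) :
    ∫⁻ ω in A, ENNReal.ofReal (firstRatio (M ω) ^ θ) ∂P =
      ENNReal.ofReal θ * ∫⁻ t in Ioi 0, P ({ω | M ω (ratioLe t) = 0} ∩ A) *
        ENNReal.ofReal (t ^ (θ - 1)) := by
  have hg := ae_firstRatio_bounds h0 h1 hM
  have hm := (aemeasurable_firstRatio hM.measurable hg).restrict (s := A)
  have hg' := ae_restrict_of_ae (s := A) hg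
  have hnn : 0 ≤ᵐ[P.restrict A] fun ω => firstRatio (M ω) := by
    filter_upwards [hg'] with ω hω using (firstRatio_bounds hω.1 hω.2).2 0 hω.1
  have hr : ∀ t, P.restrict A {ω | M ω (ratioLe t) = 0} = P ({ω | M ω (ratioLe t) = 0} ∩ A) :=
    fun t => Measure.restrict_apply
      (((Measure.measurable_coe (measurableSet_ratioLe t)).comp hM.measurable)
        (measurableSet_singleton 0))
  refine le_antisymm ?_ ?_
  · rw [lintegral_rpow_eq_lintegral_meas_lt_mul _ hnn hm hθ]
    refine mul_le_mul_right (lintegral_mono fun t => mul_le_mul_left ?_ _) _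
    rw [← hr]
    refine measure_mono_ae ?_
    filter_upwards [hg'] with ω hω ht
    by_contra h
    exact ((firstRatio_bounds hω.1 hω.2).1 t h).not_gt ht
  · rw [lintegral_rpow_eq_lintegral_meas_le_mul _ hnn hm hθ]
    refine mul_le_mul_right (lintegral_mono fun t => mul_le_mul_left ?_ _) _
    rw [← hr]
    refine measure_mono_ae ?_
    filter_upwards [hg'] with ω hω ht using (firstRatio_bounds hω.1 hω.2).2 t ht

end FirstPoint

/-! ### The Poisson-Dirichlet law as a gamma mixture -/

section Mixture

theorem pointSum_map {X : Type*} [MeasurableSpace X] (m : Measure X) {f : X → ℝ}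
    (hf : Measurable f) : pointSum (m.map f) = ∫⁻ x, ENNReal.ofReal (f x) ∂m := by
  rw [pointSum, lintegral_map (by fun_prop) hf]

theorem selfNormalize_map {X : Type*} [MeasurableSpace X] (m : Measure X) {f : X → ℝ}
    (hf : Measurable f) :
    selfNormalize (m.map f) =
      m.map fun x => f x / (∫⁻ x, ENNReal.ofReal (f x) ∂m).toReal := by
  rw [selfNormalize, pointSum_map m hf, Measure.map_map (by fun_prop) hf]
  rfl

theorem selfNormalize_map_const_mul {X : Type*} [MeasurableSpace X] (m : Measure X) {f : X → ℝ}
    (hf : Measurable f) {c : ℝ} (hc : 0 < c) :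
    selfNormalize (m.map fun x => c * f x) = selfNormalize (m.map f) := by
  rw [selfNormalize_map m hf, selfNormalize_map m (hf.const_mul c)]
  congr 1
  ext x
  simp_rw [ENNReal.ofReal_mul hc.le]
  rw [lintegral_const_mul _ (by fun_prop), ENNReal.toReal_mul, ENNReal.toReal_ofReal hc.le,
    mul_div_mul_left _ _ hc.ne']

instance (s α : ℝ) : SigmaFinite (ENNReal.ofReal s • thinnedMeasure α) := by
  have := SigmaFinite.withDensity_ofReal (μ := thinnedMeasure α) fun _ => s
  rwa [withDensity_const] at this

variable {Ω : Type*} [MeasurableSpace Ω] {P : Measure Ω} {α : ℝ} {M : Ω → Measure (ℝ × ℝ)}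

/-- The core of the mixture: the event concerns only pairs with ratio ≤ t, and given it the
self-normalized points depend only on the other pairs, so the probability factorizes. Rescaling by t
identifies the second factor, and uniqueness in law allows any Poisson process `N` with that
intensity. -/
theorem measure_ratioLe_inter_selfNormalize (h0 : 0 < α) (h1 : α < 1)
    (hM : IsPoissonProcess P M ((stableMeasure α).prod (expMeasure 1))) {t : ℝ} (ht : 0 < t)
    {Ω' : Type*} [MeasurableSpace Ω'] {P' : Measure Ω'} {N : Ω' → Measure ℝ}
    (hN : IsPoissonProcess P' N (ENNReal.ofReal (t ^ α) • thinnedMeasure α))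
    {A : Set (Measure ℝ)} (hA : MeasurableSet A) :
    P ({ω | M ω (ratioLe t) = 0} ∩ (fun ω => selfNormalize ((M ω).map Prod.fst)) ⁻¹' A) =
      ENNReal.ofReal (Real.exp (-(t ^ α))) * P'.map (fun ω => selfNormalize (N ω)) A := by
  have hC := measurableSet_ratioLe t
  have hf : Measurable fun q : ℝ × ℝ => t * q.1 := by fun_prop
  have hW := hM.restrict_map hC.compl hf
  rw [compl_ratioLe, map_restrict_stable_prod_exp h0 h1 ht, ← compl_ratioLe] at hW
  set W : Ω → Measure ℝ := fun ω => ((M ω).restrict (ratioLe t)ᶜ).map fun q => t * q.1 with hWdef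
  rw [hN.map_selfNormalize_eq hW, Measure.map_apply_of_aemeasurable
    hW.aemeasurable_selfNormalize hA]
  let V : Measure (ℝ × ℝ) → Measure ℝ := fun m =>
    selfNormalize (regularize (ENNReal.ofReal (t ^ α) • thinnedMeasure α) (m.map fun q => t * q.1))
  have hV : Measurable V :=
    (measurable_selfNormalize_regularize _).comp (Measure.measurable_map _ hf)
  have hVW : ∀ᵐ ω ∂P, V ((M ω).restrict (ratioLe t)ᶜ) = selfNormalize (W ω) := by
    filter_upwards [hW.ae_regularize fun k => (measure_spanningSets_lt_top _ k).ne] with ω hω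
    simp only [V]
    rw [hω]
  have hind := (hM.indepFun_restrict hC hC.compl disjoint_compl_right).comp hV measurable_id
  have h2 := hind.measure_inter_preimage_eq_mul A {0} hA (measurableSet_singleton 0)
  have h3 : P {ω | M ω (ratioLe t) = 0} = ENNReal.ofReal (Real.exp (-(t ^ α))) := by
    have := stable_prod_exp_le h0 h1 ht.le
    rw [hM.measure_eq_zero hC (by rw [ratioLe, this]; simp), ratioLe, this,
      ENNReal.toReal_ofReal (by positivity)]
  rw [← h3, mul_comm]
  calc _ = P ((V ∘ fun ω => (M ω).restrict (ratioLe t)ᶜ) ⁻¹' A ∩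
        (id ∘ fun ω => M ω (ratioLe t)) ⁻¹' {0}) := by
        refine measure_congr ?_
        filter_upwards [hVW] with ω hω
        refine propext ?_
        change (M ω (ratioLe t) = 0 ∧ selfNormalize ((M ω).map Prod.fst) ∈ A) ↔
          (V ((M ω).restrict (ratioLe t)ᶜ) ∈ A ∧ M ω (ratioLe t) = 0)
        rw [and_comm]
        refine and_congr_left fun hω0 => ?_
        rw [hω]
        simp only [hWdef]
        -- Scale invariance removes t; on the event, the discarded region carries no points, so the
        -- restriction is the whole process.
        rw [selfNormalize_map_const_mul _ measurable_fst ht, Measure.restrict_eq_self_of_ae_mem]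
        exact measure_eq_zero_iff_ae_notMem.1 hω0
    _ = _ := h2
    _ = _ := by
        congr 1
        refine measure_congr ?_
        filter_upwards [hVW] with ω hω
        refine propext ?_
        change V ((M ω).restrict (ratioLe t)ᶜ) ∈ A ↔ selfNormalize (W ω) ∈ A
        rw [hω]

/-- The substitution s = t^α, with θ/α absorbed by Γ(θ/α + 1) = (θ/α) Γ(θ/α). Measurability of `K`
is avoided, so nothing about the dependence of the laws on s has to be proved. -/
theorem lintegral_gammaMeasure_eq {θ : ℝ} (h0 : 0 < α) (hθ : 0 < θ) (K : ℝ → ℝ≥0∞) :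
    ∫⁻ s, K s ∂(gammaMeasure (θ / α) 1) =
      ENNReal.ofReal (1 / Real.Gamma (θ / α + 1)) * (ENNReal.ofReal θ * ∫⁻ t in Ioi 0,
        ENNReal.ofReal (Real.exp (-(t ^ α))) * K (t ^ α) * ENNReal.ofReal (t ^ (θ - 1))) := by
  have hG : 0 < Real.Gamma (θ / α) := Real.Gamma_pos_of_pos (by positivity)
  have himg : (fun t : ℝ => t ^ α) '' Ioi 0 = Ioi 0 := by
    ext x
    constructor
    · rintro ⟨t, ht, rfl⟩
      exact Real.rpow_pos_of_pos ht _
    · intro hx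
      exact ⟨x ^ (1 / α), Real.rpow_pos_of_pos hx _, by
        simp only
        rw [← Real.rpow_mul (le_of_lt hx), one_div_mul_cancel h0.ne', Real.rpow_one]⟩
  have hinj : InjOn (fun t : ℝ => t ^ α) (Ioi 0) :=
    ((Real.strictMonoOn_rpow_Ici_of_exponent_pos h0).mono Ioi_subset_Ici_self).injOn
  rw [gammaMeasure_eq_withDensity, lintegral_withDensity_eq_lintegral_mul_non_measurable _
    (by fun_prop) (ae_of_all _ fun _ => ENNReal.ofReal_lt_top)]
  nth_rw 1 [← himg]
  rw [lintegral_image_eq_lintegral_abs_deriv_mul measurableSet_Ioi (fun t ht =>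
    (Real.hasDerivAt_rpow_const (p := α) (Or.inl (ne_of_gt ht))).hasDerivWithinAt) hinj,
    ← lintegral_const_mul' _ _ ENNReal.ofReal_ne_top,
    ← lintegral_const_mul' _ _ ENNReal.ofReal_ne_top]
  refine setLIntegral_congr_fun measurableSet_Ioi fun t ht => ?_
  have ht : 0 < t := ht
  simp only [Pi.mul_apply]
  have h2 : ENNReal.ofReal |α * t ^ (α - 1)| *
      ENNReal.ofReal ((t ^ α) ^ (θ / α - 1) * Real.exp (-t ^ α) / Real.Gamma (θ / α)) =
      ENNReal.ofReal (1 / Real.Gamma (θ / α + 1)) * ENNReal.ofReal θ *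
      ENNReal.ofReal (Real.exp (-(t ^ α))) * ENNReal.ofReal (t ^ (θ - 1)) := by
    have hG' : 0 < Real.Gamma (θ / α + 1) := Real.Gamma_pos_of_pos (by positivity)
    rw [abs_of_pos (by positivity), ← ENNReal.ofReal_mul (by positivity),
      ← ENNReal.ofReal_mul (by positivity), ← ENNReal.ofReal_mul (by positivity),
      ← ENNReal.ofReal_mul (by positivity)]
    congr 1
    have e : t ^ (θ - 1) = t ^ (α - 1) * (t ^ α) ^ (θ / α - 1) := by
      rw [← Real.rpow_mul ht.le, ← Real.rpow_add ht]
      congr 1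
      field_simp
      ring
    rw [e, Real.Gamma_add_one (by positivity)]
    field_simp
  rw [← mul_assoc, h2]
  ring

/-- The law of the self-normalized points under the change of measure is the mixture over a gamma
variable `s` of the laws of the self-normalized Poisson processes with intensity
`s • thinnedMeasure α`. -/
theorem map_withDensity_firstRatio [IsProbabilityMeasure P] {θ : ℝ} (h0 : 0 < α) (h1 : α < 1) (hθ : 0 < θ)
    (hM : IsPoissonProcess P M ((stableMeasure α).prod (expMeasure 1)))
    (hV : AEMeasurable (fun ω => selfNormalize ((M ω).map Prod.fst)) P)
    {Ω' : Type*} [MeasurableSpace Ω'] {P' : Measure Ω'} {N : ℝ → Ω' → Measure ℝ}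
    (hN : ∀ s, 0 < s → IsPoissonProcess P' (N s) (ENNReal.ofReal s • thinnedMeasure α))
    {A : Set (Measure ℝ)} (hA : MeasurableSet A) :
    (P.withDensity fun ω => ENNReal.ofReal
      (firstRatio (M ω) ^ θ / Real.Gamma (θ / α + 1))).map
        (fun ω => selfNormalize ((M ω).map Prod.fst)) A =
      ∫⁻ s, P'.map (fun ω => selfNormalize (N s ω)) A ∂(gammaMeasure (θ / α) 1) := by
  have hG : 0 < Real.Gamma (θ / α + 1) := Real.Gamma_pos_of_pos (by positivity)
  rw [Measure.map_apply_of_aemeasurable (hV.mono_ac (withDensity_absolutelyContinuous _ _)) hA,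
    withDensity_apply', lintegral_gammaMeasure_eq h0 hθ]
  have h2 : ∀ ω, ENNReal.ofReal (firstRatio (M ω) ^ θ / Real.Gamma (θ / α + 1)) =
      ENNReal.ofReal (1 / Real.Gamma (θ / α + 1)) * ENNReal.ofReal (firstRatio (M ω) ^ θ) :=
    fun ω => by
      rw [← ENNReal.ofReal_mul (by positivity)]
      congr 1
      ring
  rw [lintegral_congr h2, lintegral_const_mul' _ _ ENNReal.ofReal_ne_top, lintegral_firstRatio_rpow h0 h1 hθ hM]
  congr 2
  refine setLIntegral_congr_fun measurableSet_Ioi fun t ht => ?_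
  rw [measure_ratioLe_inter_selfNormalize h0 h1 hM ht (hN _ (Real.rpow_pos_of_pos ht _)) hA]

end Mixture

/-! ### The two representations as gamma mixtures -/

section Conclusion

variable {Ω : Type*} [MeasurableSpace Ω] {P : Measure Ω} {α θ : ℝ}

/-- By Campbell's formula the sum has finite mean sα. It is positive because infinite total
intensity puts infinitely many points in (0, ∞). -/
theorem ae_pointSum_pos_lt_top (h0 : 0 < α) (h1 : α < 1) {s : ℝ} (hs : 0 < s)
    {N : Ω → Measure ℝ} (hN : IsPoissonProcess P N (ENNReal.ofReal s • thinnedMeasure α)) :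
    ∀ᵐ ω ∂P, 0 < pointSum (N ω) ∧ pointSum (N ω) < ∞ := by
  have hfin : ∀ᵐ ω ∂P, pointSum (N ω) < ∞ := by
    refine ae_lt_top (measurable_pointSum.comp hN.measurable) ?_
    simp only [pointSum]
    rw [hN.lintegral_lintegral (by fun_prop), lintegral_smul_measure,
      lintegral_thinnedMeasure h0 h1]
    exact ENNReal.mul_ne_top ENNReal.ofReal_ne_top ENNReal.ofReal_ne_top
  have hinf : ∀ᵐ ω ∂P, N ω (Ioi 0) = ∞ := by
    refine hN.infinite _ measurableSet_Ioi ?_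
    have : thinnedMeasure α (Ioi 0) = ∞ := by
      rw [← thinnedMeasure_univ h0 h1]
      refine measure_congr ?_
      filter_upwards [ae_pos_thinnedMeasure α] with x hx
      exact propext ⟨fun _ => trivial, fun _ => hx⟩
    rw [Measure.smul_apply, this, smul_eq_mul, ENNReal.mul_top (by simpa using hs)]
  filter_upwards [hfin, hinf] with ω h2 h3
  refine ⟨pos_iff_ne_zero.2 fun h => ?_, h2⟩
  rw [pointSum, lintegral_eq_zero_iff (by fun_prop)] at h
  have : N ω (Ioi 0) = 0 := by
    refine measure_eq_zero_iff_ae_notMem.2 ?_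
    filter_upwards [h] with x hx
    simpa using hx
  rw [this] at h3
  exact ENNReal.zero_ne_top h3

theorem ae_pos_gammaMeasure (a : ℝ) : ∀ᵐ x ∂(gammaMeasure a 1), 0 < x := by
  rw [gammaMeasure_eq_withDensity]
  exact (withDensity_absolutelyContinuous _ _).ae_le (ae_restrict_mem measurableSet_Ioi)

/-- The common end of both constructions: it remains only to show that, for each fixed s, the
process is Poisson with intensity s times the thinned measure. The mixture formula for `Q` is
assumed for every such family, so each construction can insert its own. -/
theorem hasLaw_selfNormalize_of_mixture [IsProbabilityMeasure P] (h0 : 0 < α) (h1 : α < 1)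
    (hθ : 0 < θ) {E : Type*} [MeasurableSpace E] {Z : Ω → E} {S : Ω → ℝ} (hZ : Measurable Z)
    (hS : HasLaw S (gammaMeasure (θ / α) 1) P) (hSZ : IndepFun S Z P)
    {F : ℝ × E → Measure ℝ} (hF : Measurable F)
    (hN : ∀ s, 0 < s →
      IsPoissonProcess P (fun ω => F (s, Z ω)) (ENNReal.ofReal s • thinnedMeasure α))
    {Q : Measure (Measure ℝ)}
    (hQ : ∀ N : ℝ → Ω → Measure ℝ,
      (∀ s, 0 < s → IsPoissonProcess P (N s) (ENNReal.ofReal s • thinnedMeasure α)) →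
      ∀ A, MeasurableSet A →
        Q A = ∫⁻ s, P.map (fun ω => selfNormalize (N s ω)) A ∂(gammaMeasure (θ / α) 1)) :
    (∀ᵐ ω ∂P, 0 < pointSum (F (S ω, Z ω)) ∧ pointSum (F (S ω, Z ω)) < ∞) ∧
      HasLaw (fun ω => selfNormalize (F (S ω, Z ω))) Q P := by
  have := isProbabilityMeasure_gammaMeasure (a := θ / α) (r := 1) (by positivity) one_pos
  have hm : Measurable fun q => pointSum (F q) := measurable_pointSum.comp hF
  obtain ⟨h2, h3⟩ := mixed_selfNormalize hZ hS hSZ (ae_pos_gammaMeasure _) hF hN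
  refine ⟨?_, h2, Measure.ext fun A hA => (h3 A hA).trans (hQ _ hN A hA).symm⟩
  refine ae_of_indepFun hZ hS hSZ (p := fun q => 0 < pointSum (F q) ∧ pointSum (F q) < ∞)
    ((measurableSet_lt measurable_const hm).inter (measurableSet_lt hm measurable_const)) ?_
  filter_upwards [ae_pos_gammaMeasure (θ / α)] with s hs
    using ae_pointSum_pos_lt_top h0 h1 hs (hN s hs)

theorem IsPoissonProcess.restrict_map_snd {X : Type*} [MeasurableSpace X]
    {N : Ω → Measure (ℝ × X)} {ν : Measure X} [SFinite ν]
    (hN : IsPoissonProcess P N (timeMeasure.prod ν)) (s : ℝ) :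
    IsPoissonProcess P (fun ω => ((N ω).restrict {x | x.1 ≤ s}).map Prod.snd)
      (ENNReal.ofReal s • ν) := by
  have := hN.restrict_map (C := {x | x.1 ≤ s}) (measurableSet_le (by fun_prop) (by fun_prop))
    measurable_snd
  rwa [map_snd_restrict_prod] at this

theorem IsPoissonProcess.upToTime {N : Ω → Measure (ℝ × ℝ)} {ν : Measure ℝ} [SFinite ν]
    (hN : IsPoissonProcess P N (timeMeasure.prod ν)) (s : ℝ) :
    IsPoissonProcess P (fun ω => upToTime s (N ω)) (ENNReal.ofReal s • ν) :=
  hN.restrict_map_snd s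

theorem sizeBiasedProcess_eq_map (m : Measure (ℝ × ℝ × ℝ)) :
    sizeBiasedProcess m =
      ((m.restrict {x | x.1 ≤ 1}).map Prod.snd).map fun q : ℝ × ℝ => (q.2 / q.1, q.1) := by
  rw [Measure.map_map (by fun_prop) measurable_snd]
  rfl

theorem firstPoint_sizeBiasedProcess (m : Measure (ℝ × ℝ × ℝ)) :
    firstPoint (sizeBiasedProcess m) =
      firstRatio ((m.restrict {x | x.1 ≤ 1}).map Prod.snd) := by
  rw [firstPoint, firstRatio, sizeBiasedProcess_eq_map]
  congr! 3 with z
  rw [Measure.map_apply (by fun_prop) (measurableSet_le (by fun_prop) (by fun_prop))]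
  rfl

theorem map_snd_sizeBiasedProcess (m : Measure (ℝ × ℝ × ℝ)) :
    (sizeBiasedProcess m).map Prod.snd =
      ((m.restrict {x | x.1 ≤ 1}).map Prod.snd).map Prod.fst := by
  rw [sizeBiasedProcess_eq_map, Measure.map_map measurable_snd (by fun_prop)]
  rfl

/-- Regroups one independent family indexed by a disjoint sum into independent pairs. It is enough
to test rectangles, where the probability factors over both copies of the index set. -/
theorem iIndepFun_prodMk_of_sumElim {ι : Type*} {X : Type*} [MeasurableSpace X]
    {D G : ι → Ω → X} (hD : ∀ i, Measurable (D i)) (hG : ∀ i, Measurable (G i))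
    (h : iIndepFun (Sum.elim D G) P) : iIndepFun (fun i ω => (D i ω, G i ω)) P := by
  have hgen : ∀ i, MeasurableSpace.comap (fun ω => (D i ω, G i ω)) inferInstance =
      MeasurableSpace.generateFrom (preimage (fun ω => (D i ω, G i ω)) ''
        image2 (· ×ˢ ·) {s : Set X | MeasurableSet s} {t : Set X | MeasurableSet t}) := by
    intro i
    rw [← MeasurableSpace.comap_generateFrom, generateFrom_prod]
  rw [iIndepFun_iff_iIndep]
  refine iIndepSets.iIndep (fun i => ((hD i).prodMk (hG i)).comap_le) _
    (fun i => isPiSystem_prod.comap (fun ω => (D i ω, G i ω))) hgen ?_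
  rw [iIndepSets_iff]
  intro s f hf
  have hf' : ∀ i, ∃ A B : Set X, MeasurableSet A ∧ MeasurableSet B ∧
      (i ∈ s → f i = D i ⁻¹' A ∩ G i ⁻¹' B) := by
    intro i
    by_cases hi : i ∈ s
    · obtain ⟨_, ⟨A, hA, B, hB, rfl⟩, h2⟩ := hf i hi
      exact ⟨A, B, hA, hB, fun _ => h2.symm⟩
    · exact ⟨∅, ∅, .empty, .empty, fun h => absurd h hi⟩
  choose A B hA hB hAB using hf'
  have hprod : ∀ t : Finset ι, P (⋂ i ∈ t, (D i ⁻¹' A i ∩ G i ⁻¹' B i)) =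
      (∏ i ∈ t, P (D i ⁻¹' A i)) * ∏ i ∈ t, P (G i ⁻¹' B i) := by
    intro t
    have := h.measure_inter_preimage_eq_mul (t.disjSum t) (sets := Sum.elim A B)
      (fun i _ => by rcases i with i | i; exacts [hA i, hB i])
    rw [Finset.prod_disjSum] at this
    refine Eq.trans ?_ this
    congr 1
    ext ω
    simp only [mem_iInter, mem_inter_iff, mem_preimage, Finset.mem_disjSum]
    constructor
    · rintro h2 _ (⟨i, hi, rfl⟩ | ⟨i, hi, rfl⟩)
      exacts [(h2 i hi).1, (h2 i hi).2]
    · exact fun h2 i hi => ⟨h2 (.inl i) (.inl ⟨i, hi, rfl⟩), h2 (.inr i) (.inr ⟨i, hi, rfl⟩)⟩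
  have h2 : ⋂ i ∈ s, f i = ⋂ i ∈ s, (D i ⁻¹' A i ∩ G i ⁻¹' B i) :=
    iInter₂_congr fun i hi => hAB i hi
  rw [h2, hprod, ← Finset.prod_mul_distrib]
  refine Finset.prod_congr rfl fun i hi => ?_
  have := hprod {i}
  simp only [Finset.mem_singleton, iInter_iInter_eq_left, Finset.prod_singleton] at this
  rw [hAB i hi, this]

theorem iIndepFun.indepFun_pi_of_sumElim {X ι : Type*} [MeasurableSpace X]
    {S : Ω → X} {D : ι → Ω → X} (hS : Measurable S) (hD : ∀ i, Measurable (D i))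
    (h : iIndepFun (Sum.elim (fun _ : Unit => S) D) P) : IndepFun S (fun ω i => D i ω) P := by
  have hm : ∀ i, Measurable (Sum.elim (fun _ : Unit => S) D i) := by
    rintro (_ | i)
    exacts [hS, hD i]
  have h2 := indep_iSup_of_disjoint (fun i => (hm i).comap_le) ((iIndepFun_iff_iIndep _ _ _).1 h)
    (S := {Sum.inl ()}) (T := range Sum.inr) (by simp)
  rw [IndepFun_iff_Indep]
  refine indep_of_indep_of_le_left (indep_of_indep_of_le_right h2 ?_) ?_
  · rw [MeasurableSpace.pi, MeasurableSpace.comap_iSup]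
    refine iSup_le fun i => ?_
    rw [MeasurableSpace.comap_comp]
    exact le_iSup₂_of_le (f := fun j (_ : j ∈ range (Sum.inr : ι → Unit ⊕ ι)) =>
      MeasurableSpace.comap (Sum.elim (fun _ : Unit => S) D j) _) (Sum.inr i) ⟨i, rfl⟩ le_rfl
  · exact le_iSup₂_of_le (f := fun j (_ : j ∈ ({Sum.inl ()} : Set (Unit ⊕ ι))) =>
      MeasurableSpace.comap (Sum.elim (fun _ : Unit => S) D j) _) (Sum.inl ()) rfl le_rfl

theorem measurable_mixedGammaProcess (α : ℝ) :
    Measurable fun q : ℝ × (ℕ ⊕ ℕ → ℝ) =>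
      mixedGammaProcess α q.1 (fun i => q.2 (.inl i)) fun i => q.2 (.inr i) := by
  refine Measure.measurable_of_measurable_coe _ fun B hB => ?_
  simp_rw [mixedGammaProcess, Measure.sum_apply _ hB]
  refine Measurable.tsum fun i => ?_
  refine (Measure.measurable_coe hB).comp (Measure.measurable_dirac.comp ?_)
  fun_prop

/-- For fixed s the process is the image of the renewal process with waiting times D and marks G, so
the mapping property and the computation of the image intensity apply. -/
theorem isPoissonProcess_mixedGammaProcess [IsProbabilityMeasure P] (h0 : 0 < α) (h1 : α < 1)
    {G D : ℕ → Ω → ℝ} (hGm : ∀ i, Measurable (G i)) (hDm : ∀ i, Measurable (D i))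
    (hG : ∀ i, HasLaw (G i) (gammaMeasure (1 - α) 1) P) (hD : ∀ i, HasLaw (D i) (expMeasure 1) P)
    (h : iIndepFun (Sum.elim G D) P) {s : ℝ} (hs : 0 < s) :
    IsPoissonProcess P (fun ω => mixedGammaProcess α s (G · ω) (D · ω))
      (ENNReal.ofReal s • thinnedMeasure α) := by
  have := isProbabilityMeasure_gammaMeasure (a := 1 - α) (r := 1) (by linarith) one_pos
  have hp := iIndepFun_prodMk_of_sumElim hGm hDm h
  have hM : IsMarkedExpSeq P D G (gammaMeasure (1 - α) 1) := by
    refine ⟨hDm, hGm, hp.comp (fun _ => Prod.swap) fun _ => measurable_swap, fun i => ?_⟩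
    have hi : IndepFun (D i) (G i) P := h.indepFun (i := Sum.inr i) (j := Sum.inl i) (by simp)
    refine ⟨((hDm i).prodMk (hGm i)).aemeasurable, ?_⟩
    rw [(indepFun_iff_map_prod_eq_prod_map_map (hDm i).aemeasurable (hGm i).aemeasurable).1 hi,
      (hD i).map_eq, (hG i).map_eq]
  have hf : Measurable fun p : ℝ × ℝ => p.2 * (s / (s + p.1)) ^ (1 / α) := by fun_prop
  have hP := hM.isPoissonProcess.map hf
  rw [map_mixedGamma h0 h1 hs] at hP
  convert hP using 2 with ω
  rw [renewalProcess, Measure.map_sum hf.aemeasurable]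
  simp_rw [Measure.map_dirac' hf]
  rfl


theorem hasLaw_selfNormalize_upToTime [IsProbabilityMeasure P] (h0 : 0 < α) (h1 : α < 1)
    (hθ : 0 < θ) {N : Ω → Measure (ℝ × ℝ)} {S : Ω → ℝ}
    (hN : IsPoissonProcess P N (timeMeasure.prod (thinnedMeasure α)))
    (hS : HasLaw S (gammaMeasure (θ / α) 1) P) (hSN : IndepFun S N P)
    {Q : Measure (Measure ℝ)}
    (hQ : ∀ N : ℝ → Ω → Measure ℝ,
      (∀ s, 0 < s → IsPoissonProcess P (N s) (ENNReal.ofReal s • thinnedMeasure α)) →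
      ∀ A, MeasurableSet A →
        Q A = ∫⁻ s, P.map (fun ω => selfNormalize (N s ω)) A ∂(gammaMeasure (θ / α) 1)) :
    (∀ᵐ ω ∂P, 0 < pointSum (upToTime (S ω) (N ω)) ∧ pointSum (upToTime (S ω) (N ω)) < ∞) ∧
      HasLaw (fun ω => selfNormalize (upToTime (S ω) (N ω))) Q P := by
  have hν := fun k => (measure_spanningSets_lt_top (timeMeasure.prod (thinnedMeasure α)) k).ne
  have hreg := hN.ae_regularize hν
  have hF := measurable_upToTime_regularize (timeMeasure.prod (thinnedMeasure α))
  -- From here on only two properties of this kernel matter: joint measurability, and being the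
  -- identity on N almost surely.
  generalize regularize (timeMeasure.prod (thinnedMeasure α)) = κ at hreg hF
  have hP : ∀ s, 0 < s → IsPoissonProcess P (fun ω => upToTime s (κ (N ω)))
      (ENNReal.ofReal s • thinnedMeasure α) := fun s _ => by
    refine (hN.upToTime s).congr ?_ ?_
    · exact Measurable.comp (g := fun p : ℝ × Measure (ℝ × ℝ) =>
        upToTime p.1 (κ p.2)) hF (measurable_const.prodMk hN.measurable)
    · filter_upwards [hreg] with ω hω
      rw [hω]
  obtain ⟨h2, h3⟩ := hasLaw_selfNormalize_of_mixture h0 h1 hθ hN.measurable hS hSN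
    (F := fun p => upToTime p.1 (κ p.2)) hF hP hQ
  constructor
  · filter_upwards [h2, hreg] with ω h4 hω
    rwa [hω] at h4
  · refine h3.congr ?_
    filter_upwards [hreg] with ω hω
    rw [hω]

theorem hasLaw_selfNormalize_mixedGammaProcess [IsProbabilityMeasure P] (h0 : 0 < α) (h1 : α < 1)
    (hθ : 0 < θ) {S : Ω → ℝ} {G D : ℕ → Ω → ℝ} (hS : HasLaw S (gammaMeasure (θ / α) 1) P)
    (hG : ∀ i, HasLaw (G i) (gammaMeasure (1 - α) 1) P) (hD : ∀ i, HasLaw (D i) (expMeasure 1) P)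
    (h : iIndepFun (Sum.elim (fun _ : Unit => S) (Sum.elim G D)) P)
    {Q : Measure (Measure ℝ)}
    (hQ : ∀ N : ℝ → Ω → Measure ℝ,
      (∀ s, 0 < s → IsPoissonProcess P (N s) (ENNReal.ofReal s • thinnedMeasure α)) →
      ∀ A, MeasurableSet A →
        Q A = ∫⁻ s, P.map (fun ω => selfNormalize (N s ω)) A ∂(gammaMeasure (θ / α) 1)) :
    (∀ᵐ ω ∂P, 0 < pointSum (mixedGammaProcess α (S ω) (G · ω) (D · ω)) ∧
      pointSum (mixedGammaProcess α (S ω) (G · ω) (D · ω)) < ∞) ∧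
      HasLaw (fun ω => selfNormalize (mixedGammaProcess α (S ω) (G · ω) (D · ω))) Q P := by
  let X : Unit ⊕ ℕ ⊕ ℕ → Ω → ℝ := Sum.elim (fun _ : Unit => S) (Sum.elim G D)
  have hX : ∀ i, AEMeasurable (X i) P := by
    rintro (_ | i | i)
    exacts [hS.aemeasurable, (hG i).aemeasurable, (hD i).aemeasurable]
  -- The law hypotheses give only almost everywhere measurability, so all variables are replaced at
  -- once by measurable versions; countability makes the exceptional set null.
  let Y : Unit ⊕ ℕ ⊕ ℕ → Ω → ℝ := fun i => (hX i).mk (X i)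
  have hYm : ∀ i, Measurable (Y i) := fun i => (hX i).measurable_mk
  have hXY : ∀ i, X i =ᵐ[P] Y i := fun i => (hX i).ae_eq_mk
  have hY : iIndepFun Y P := h.congr hXY
  have hS' : HasLaw (Y (.inl ())) (gammaMeasure (θ / α) 1) P := hS.congr (hXY _).symm
  have hGD : iIndepFun (Sum.elim (fun i => Y (.inr (.inl i))) fun i => Y (.inr (.inr i))) P := by
    convert hY.precomp Sum.inr_injective using 1
    ext (i | i) <;> rfl
  have hSY : iIndepFun (Sum.elim (fun _ : Unit => Y (.inl ())) fun i => Y (.inr i)) P := by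
    convert hY using 1
    ext (i | i) <;> rfl
  have hP := fun s (hs : 0 < s) => isPoissonProcess_mixedGammaProcess h0 h1
    (fun i => hYm _) (fun i => hYm _)
    (fun i => (hG i).congr (hXY (.inr (.inl i))).symm)
    (fun i => (hD i).congr (hXY (.inr (.inr i))).symm) hGD hs
  obtain ⟨h2, h3⟩ := hasLaw_selfNormalize_of_mixture h0 h1 hθ
    (Z := fun ω i => Y (.inr i) ω) (measurable_pi_lambda _ fun i => hYm (.inr i)) hS'
    (iIndepFun.indepFun_pi_of_sumElim (hYm _) (fun i => hYm _) hSY)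
    (F := fun q => mixedGammaProcess α q.1 (fun i => q.2 (.inl i)) fun i => q.2 (.inr i))
    (measurable_mixedGammaProcess α) hP hQ
  have hae : ∀ᵐ ω ∂P, mixedGammaProcess α (Y (.inl ()) ω) (fun i => Y (.inr (.inl i)) ω)
      (fun i => Y (.inr (.inr i)) ω) = mixedGammaProcess α (S ω) (G · ω) (D · ω) := by
    filter_upwards [ae_all_iff.2 hXY] with ω hω
    simp only [← hω]
    rfl
  constructor
  · filter_upwards [h2, hae] with ω h4 hω
    rwa [hω] at h4
  · refine h3.congr ?_
    filter_upwards [hae] with ω hω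
    rw [hω]

end Conclusion

end PoissonDirichlet

end

theorem proposition4p5 (α θ : ℝ) (hα₀ : 0 < α) (hα₁ : α < 1) (hθ : 0 < θ) :
    ∃ Q : Measure (Measure ℝ), IsPoissonDirichlet α θ Q ∧
      -- the thinned Poisson process `N` up to an independent gamma time `S`
      (∀ (Ω : Type*) [MeasurableSpace Ω] (P : Measure Ω) [IsProbabilityMeasure P]
        (N : Ω → Measure (ℝ × ℝ)) (S : Ω → ℝ),
        IsPoissonProcess P N (timeMeasure.prod (thinnedMeasure α)) →
        HasLaw S (gammaMeasure (θ / α) 1) P →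
        IndepFun S N P →
        (∀ᵐ ω ∂P, 0 < pointSum (upToTime (S ω) (N ω)) ∧
          pointSum (upToTime (S ω) (N ω)) < ∞) ∧
        HasLaw (fun ω => selfNormalize (upToTime (S ω) (N ω))) Q P) ∧
      -- the process `∑ δ_{Gᵢ (S / (S + Γᵢ))^{1/α}}` with an independent gamma variable `S`
      (∀ (Ω : Type*) [MeasurableSpace Ω] (P : Measure Ω) [IsProbabilityMeasure P]
        (S : Ω → ℝ) (G D : ℕ → Ω → ℝ),
        HasLaw S (gammaMeasure (θ / α) 1) P →
        (∀ i, HasLaw (G i) (gammaMeasure (1 - α) 1) P) →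
        (∀ i, HasLaw (D i) (expMeasure 1) P) →
        iIndepFun (Sum.elim (fun _ : Unit => S) (Sum.elim G D)) P →
        (∀ᵐ ω ∂P, 0 < pointSum (mixedGammaProcess α (S ω) (G · ω) (D · ω)) ∧
          pointSum (mixedGammaProcess α (S ω) (G · ω) (D · ω)) < ∞) ∧
        HasLaw (fun ω => selfNormalize (mixedGammaProcess α (S ω) (G · ω) (D · ω))) Q P) := by
  obtain ⟨Ω₀, _, P₀, _, N₀, hN₀⟩ := exists_isPoissonProcess_markedIntensity hα₀ hα₁
  have hM := hN₀.restrict_map_snd 1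
  rw [ENNReal.ofReal_one, one_smul] at hM
  have hV := (hM.map (f := Prod.fst) measurable_fst)
  rw [Measure.map_fst_prod, measure_univ, one_smul] at hV
  have hV := hV.aemeasurable_selfNormalize
  -- `Q` is chosen as the law under the changed measure on this one concrete space; the mixture
  -- formula then compares it with processes on arbitrary spaces.
  refine ⟨_, ⟨Ω₀, _, P₀, ‹_›, N₀, hN₀, ?_, rfl⟩, ?_, ?_⟩
  · simp_rw [map_snd_sizeBiasedProcess]
    exact hV.mono_ac (withDensity_absolutelyContinuous _ _)
  all_goals simp_rw [map_snd_sizeBiasedProcess, firstPoint_sizeBiasedProcess]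
  · intro Ω _ P _ N S hN hS hSN
    exact hasLaw_selfNormalize_upToTime hα₀ hα₁ hθ hN hS hSN fun N hN A hA =>
      map_withDensity_firstRatio hα₀ hα₁ hθ hM hV hN hA
  · intro Ω _ P _ S G D hS hG hD h
    exact hasLaw_selfNormalize_mixedGammaProcess hα₀ hα₁ hθ hS hG hD h fun N hN A hA =>
      map_withDensity_firstRatio hα₀ hα₁ hθ hM hV hN hA
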